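/- Fix $N\in\mathbb N$ and $r>0$. Let $\mathscr L^{\pm}$ be the set of Lipschitz functions $g:\mathbb R^N\to\mathbb R$ with $\lim_{|x|\to\infty}g(x)=\pm\infty$, let $\mathrm{Lip}(g)$ be the best Lipschitz constant of $g$, and put $C_r=\overline{B_r}\times\overline{B_r}$. For a measurable set $A$ let $\operatorname{osc}_A v=\operatorname{ess\,sup}_A v-\operatorname{ess\,inf}_A v$, and for a Lebesgue measurable set $F\subset\mathbb R^N$ let $$\mathrm{Per}_r(F)=\frac1{2r}\int_{\mathbb R^N}\operatorname{osc}_{B_r(w)}\chi_F\,dw .$$ Let $L^\infty_{\mathbf w}(\mathbb R^N;\mathcal M^+(C_r))$ be the set of maps $w\mapsto z_w$ from $\mathbb R^N$ to the nonnegative Radon measures on $C_r$ such that $w\mapsto\int_{C_r}f\,dz_w$ is measurable for every $f\in C^0(C_r)$ and $w\mapsto z_w(C_r)$ is essentially bounded. For such $z$, the nonlocal divergence $\mathfrak{Div}^r z$ is the Radon measure on $\mathbb R^N$ with $$\int\varphi\,d(\mathfrak{Div}^r z)=-\frac1{2r}\int_{\mathbb R^N}\int_{C_r}\bigl(\varphi(w+x)-\varphi(w+y)\bigr)\,dz_w(x,y)\,dw\qquad\text{for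 all }\varphi\in C^0_c(\mathbb R^N).$$ Let $h>0$. **Theorem.** Let $g\in\mathscr L^+$ (respectively $g\in\mathscr L^-$). There is a unique function $u=u^g_h\in\mathscr L^+$ (respectively $\mathscr L^-$) for which there exists $z\in L^\infty_{\mathbf w}(\mathbb R^N;\mathcal M^+(C_r))$ such that (a) $z$ is a nonlocal Cahn–Hoffman field for $u$: for a.e. $w\in\mathbb R^N$ one has $z_w(C_r)\le1$ and $\displaystyle\int_{C_r}\bigl(u(w+x)-u(w+y)\bigr)\,dz_w(x,y)=\operatorname{osc}_{B_r(w)}u$; (b) $-h\,\mathfrak{Div}^r z+u=g$ as Radon measures on $\mathbb R^N$ (functions being identified with their products with Lebesgue measure). Moreover $\mathrm{Lip}(u^g_h)\le\mathrm{Lip}(g)$. For every $t\in\mathbb R$, if $g\in\mathscr L^+$, the sets $\{u^g_h<t\}$ and $\{u^g_h\le t\}$ are, up to null sets, the minimal and the maximal minimizer (with respect to inclusion up to null sets), respectively, of $$F\mapsto\mathrm{Per}_r(F)+\frac1h\int_F(g(w)-t)\,dw$$ among Lebesgue measurable sets $F\subset\mathbb R^N$; if $g\in\mathscr L^-$, the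 sets $\{u^g_h>t\}$ and $\{u^g_h\ge t\}$ are the minimal and the maximal minimizer, respectively, of $F\mapsto\mathrm{Per}_r(F)+\frac1h\int_F(t-g(w))\,dw$. Finally, if $g_1,g_2\in\mathscr L^+\cup\mathscr L^-$ and $g_1\le g_2$, then $u^{g_1}_h\le u^{g_2}_h$. -/

import Mathlib

open MeasureTheory Filter Topology
open scoped NNReal ENNReal

noncomputable section

namespace NonlocalROF

/-- The Euclidean space of dimension `N`. -/
abbrev Space (N : ℕ) : Type := EuclideanSpace ℝ (Fin N)

/-- Lipschitz functions that tend to `+∞` at infinity. -/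
def LipPlus (N : ℕ) : Set (Space N → ℝ) :=
  {g | (∃ K : ℝ≥0, LipschitzWith K g) ∧ Tendsto g (cocompact (Space N)) atTop}

/-- Lipschitz functions that tend to `-∞` at infinity. -/
def LipMinus (N : ℕ) : Set (Space N → ℝ) :=
  {g | (∃ K : ℝ≥0, LipschitzWith K g) ∧ Tendsto g (cocompact (Space N)) atBot}

/-- The best Lipschitz constant of `f` (`⊤` if `f` is not Lipschitz). -/
def lipConst {N : ℕ} (f : Space N → ℝ) : ℝ≥0∞ :=
  ⨅ (K : ℝ≥0) (_ : LipschitzWith K f), (K : ℝ≥0∞)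

/-- The essential oscillation of `v` over `A`: essential supremum minus essential infimum, both
taken in the extended reals with respect to Lebesgue measure. -/
def essOsc {N : ℕ} (A : Set (Space N)) (v : Space N → ℝ) : EReal :=
  essSup (fun x => (v x : EReal)) (volume.restrict A) -
    essInf (fun x => (v x : EReal)) (volume.restrict A)

/-- The nonlocal total variation `(1 / 2r) ∫ osc_{B_r(w)} v dw`, with values in `[0, ∞]`. -/
def nonlocalTV {N : ℕ} (r : ℝ) (v : Space N → ℝ) : ℝ≥0∞ :=
  ENNReal.ofReal (1 / (2 * r)) * ∫⁻ w, (essOsc (Metric.ball w r) v).toENNReal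

/-- The nonlocal perimeter: the nonlocal total variation of the characteristic function. -/
def nonlocalPer {N : ℕ} (r : ℝ) (F : Set (Space N)) : ℝ≥0∞ :=
  nonlocalTV r (F.indicator fun _ => (1 : ℝ))

/-- The integral of `f` over `F` in the extended reals: the integral of the positive part minus
that of the negative part. -/
def extIntegral {N : ℕ} (F : Set (Space N)) (f : Space N → ℝ) : EReal :=
  ((∫⁻ x in F, ENNReal.ofReal (f x) : ℝ≥0∞) : EReal) -
    ((∫⁻ x in F, ENNReal.ofReal (-f x) : ℝ≥0∞) : EReal)

/-- The geometric functional `Per_r(F) + (1/h) ∫_F f`. -/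
def geomEnergy {N : ℕ} (r h : ℝ) (f : Space N → ℝ) (F : Set (Space N)) : EReal :=
  (nonlocalPer r F : EReal) + ((1 / h : ℝ) : EReal) * extIntegral F f

/-- `F` minimizes `Per_r + (1/h) ∫ f` among all Lebesgue measurable sets. -/
def IsGeomMinimizer {N : ℕ} (r h : ℝ) (f : Space N → ℝ) (F : Set (Space N)) : Prop :=
  NullMeasurableSet F volume ∧
    ∀ G : Set (Space N), NullMeasurableSet G volume → geomEnergy r h f F ≤ geomEnergy r h f G

/-- `F` is the minimal minimizer: a minimizer contained, up to a null set, in every minimizer. -/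
def IsMinimalMinimizer {N : ℕ} (r h : ℝ) (f : Space N → ℝ) (F : Set (Space N)) : Prop :=
  IsGeomMinimizer r h f F ∧ ∀ G, IsGeomMinimizer r h f G → F ≤ᵐ[volume] G

/-- `F` is the maximal minimizer: a minimizer containing, up to a null set, every minimizer. -/
def IsMaximalMinimizer {N : ℕ} (r h : ℝ) (f : Space N → ℝ) (F : Set (Space N)) : Prop :=
  IsGeomMinimizer r h f F ∧ ∀ G, IsGeomMinimizer r h f G → G ≤ᵐ[volume] F

/-- The compact set `C_r`, the product of the closed ball of radius `r` at `0` with itself. -/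
def ballPair (N : ℕ) (r : ℝ) : Set (Space N × Space N) :=
  Metric.closedBall 0 r ×ˢ Metric.closedBall 0 r

/-- Nonnegative fields in `L^∞_w(ℝ^N; M(C_r))`. On the compact metric space `C_r` the nonnegative
Radon measures are the finite Borel measures. The field is weakly measurable (for the Lebesgue
`σ`-algebra) and its mass is essentially bounded. -/
def IsBoundedField {N : ℕ} (r : ℝ) (z : Space N → FiniteMeasure (ballPair N r)) : Prop :=
  (∀ f : C(ballPair N r, ℝ),
    AEMeasurable (fun w => ∫ p, f p ∂(z w : Measure (ballPair N r))) volume) ∧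
  MemLp (fun w => ((z w).mass : ℝ)) ∞ volume

/-- The integral over `C_r` of `φ(w + x) - φ(w + y)` against `z_w`. -/
def fieldAction {N : ℕ} (r : ℝ) (z : Space N → FiniteMeasure (ballPair N r))
    (φ : Space N → ℝ) (w : Space N) : ℝ :=
  ∫ p, (φ (w + p.1.1) - φ (w + p.1.2)) ∂(z w : Measure (ballPair N r))

/-- `z` is a generalised nonlocal Cahn–Hoffman field for `u`. -/
def IsCahnHoffmanField {N : ℕ} (r : ℝ) (u : Space N → ℝ)
    (z : Space N → FiniteMeasure (ballPair N r)) : Prop :=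
  IsBoundedField r z ∧
    ∀ᵐ w : Space N, (z w).mass ≤ 1 ∧
      (fieldAction r z u w : EReal) = essOsc (Metric.ball w r) u

/-- The nonlocal divergence of `z`, a Radon measure given by its action on continuous compactly
supported functions. -/
def nonlocalDiv {N : ℕ} (r : ℝ) (z : Space N → FiniteMeasure (ballPair N r))
    (φ : Space N → ℝ) : ℝ :=
  -(1 / (2 * r)) * ∫ w, fieldAction r z φ w

/-- The identity `-h Div^r z + u = g` between Radon measures on `ℝ^N`, where a function stands for
its product with Lebesgue measure: both sides have the same action on `C_c(ℝ^N)`. -/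
def SolvesEquation {N : ℕ} (r h : ℝ) (g u : Space N → ℝ)
    (z : Space N → FiniteMeasure (ballPair N r)) : Prop :=
  ∀ φ : Space N → ℝ, Continuous φ → HasCompactSupport φ →
    -h * nonlocalDiv r z φ + ∫ w, φ w * u w = ∫ w, φ w * g w

/-- `u` satisfies the Euler–Lagrange system with datum `g`: for some Cahn–Hoffman field `z` of `u`,
`-h Div^r z + u = g` as measures. -/
def IsSolution {N : ℕ} (r h : ℝ) (g u : Space N → ℝ) : Prop :=
  ∃ z : Space N → FiniteMeasure (ballPair N r),
    IsCahnHoffmanField r u z ∧ SolvesEquation r h g u z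

end NonlocalROF

end

/-!
**Existence.** Replace the supremum and infimum of `u` over the ball `B_r(w)` by averages of `u`
against the Gibbs measures on the ball with density proportional to `exp (±β u)`. The sup-like and
inf-like terms of the regularized Euler–Lagrange equation are monotone in `u` and commute with
translations, so the equation is solved by a contraction whose fixed point inherits every Lipschitz
constant of `g`. The products of Gibbs measures are approximate Cahn–Hoffman fields of the
regularized solutions. As `β → ∞`, Arzelà–Ascoli gives a limit of the solutions, and compactness of
Young measures a limit of the fields.

**Comparison.** A Cahn–Hoffman field of `u` transports mass from minima to maxima of `u` on balls.
For a monotone truncation `ψ`, testing the difference of the two equations with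
`max (ψ ∘ u₁) (ψ ∘ u₂) - ψ ∘ u₂` gives `∫ (u₁ - u₂) (ψ ∘ u₁ - ψ ∘ u₂)⁺ ≤ 0` when `g₁ ≤ g₂`.

**Level sets.** The field of `u` calibrates the sublevel sets of `u`: testing the equation with the
indicator of `G` bounds the energy of `G` from below, with equality for `{u < t}` and `{u ≤ t}`.
Functions tending to `-∞` are reduced to functions tending to `+∞` by `u ↦ -u`, which swaps the two
coordinates of the field.
-/

noncomputable section

namespace NonlocalROF

open Metric Set ProbabilityTheory

section Oscillation

variable {X : Type*} [PseudoMetricSpace X] {r : ℝ} {f g : X → ℝ} {w x y : X}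

/-- The supremum of `f` over the closed ball `closedBall w r`; the junk value `0` of `sSup` occurs
only when `f` is unbounded there or `r < 0`. -/
def ballSup (r : ℝ) (f : X → ℝ) (w : X) : ℝ := sSup (f '' closedBall w r)

/-- The infimum of `f` over the closed ball `closedBall w r`. -/
def ballInf (r : ℝ) (f : X → ℝ) (w : X) : ℝ := sInf (f '' closedBall w r)

/-- The oscillation of `f` over the closed ball `closedBall w r`. For continuous functions on
Euclidean space it agrees with the essential oscillation over the open ball. -/
def ballOsc (r : ℝ) (f : X → ℝ) (w : X) : ℝ := ballSup r f w - ballInf r f w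

theorem ballInf_eq_neg_ballSup_neg (r : ℝ) (f : X → ℝ) (w : X) :
    ballInf r f w = -ballSup r (fun x => -f x) w := by
  rw [ballInf, ballSup, Real.sInf_def, ← image_neg_eq_neg, image_image]

theorem ballOsc_neg (r : ℝ) (f : X → ℝ) (w : X) :
    ballOsc r (fun x => -f x) w = ballOsc r f w := by
  simp only [ballOsc, ballInf_eq_neg_ballSup_neg, neg_neg]
  ring

theorem ballSup_le {a : ℝ} (hr : 0 ≤ r) (h : ∀ x ∈ closedBall w r, f x ≤ a) :
    ballSup r f w ≤ a :=
  csSup_le ((nonempty_closedBall.2 hr).image f) (forall_mem_image.2 h)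

theorem le_ballInf {a : ℝ} (hr : 0 ≤ r) (h : ∀ x ∈ closedBall w r, a ≤ f x) :
    a ≤ ballInf r f w :=
  le_csInf ((nonempty_closedBall.2 hr).image f) (forall_mem_image.2 h)

variable [ProperSpace X]

theorem exists_eq_ballSup (hr : 0 ≤ r) (hf : Continuous f) (w : X) :
    ∃ x ∈ closedBall w r, f x = ballSup r f w :=
  let ⟨x, hx, h⟩ := (isCompact_closedBall w r).exists_sSup_image_eq (nonempty_closedBall.2 hr)
    hf.continuousOn
  ⟨x, hx, h.symm⟩

theorem exists_eq_ballInf (hr : 0 ≤ r) (hf : Continuous f) (w : X) :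
    ∃ x ∈ closedBall w r, f x = ballInf r f w :=
  let ⟨x, hx, h⟩ := (isCompact_closedBall w r).exists_sInf_image_eq (nonempty_closedBall.2 hr)
    hf.continuousOn
  ⟨x, hx, h.symm⟩

theorem le_ballSup (hf : Continuous f) (hx : x ∈ closedBall w r) : f x ≤ ballSup r f w :=
  le_csSup ((isCompact_closedBall w r).bddAbove_image hf.continuousOn) (mem_image_of_mem f hx)

theorem ballInf_le (hf : Continuous f) (hx : x ∈ closedBall w r) : ballInf r f w ≤ f x :=
  csInf_le ((isCompact_closedBall w r).bddBelow_image hf.continuousOn) (mem_image_of_mem f hx)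

theorem sub_le_ballOsc (hf : Continuous f) (hx : x ∈ closedBall w r) (hy : y ∈ closedBall w r) :
    f x - f y ≤ ballOsc r f w :=
  sub_le_sub (le_ballSup hf hx) (ballInf_le hf hy)

theorem ballInf_le_ballSup (hr : 0 ≤ r) (hf : Continuous f) (w : X) :
    ballInf r f w ≤ ballSup r f w :=
  (ballInf_le hf (mem_closedBall_self hr)).trans (le_ballSup hf (mem_closedBall_self hr))

theorem ballOsc_nonneg (hr : 0 ≤ r) (hf : Continuous f) (w : X) : 0 ≤ ballOsc r f w :=
  sub_nonneg.2 (ballInf_le_ballSup hr hf w)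

theorem ballOsc_comp_le {ψ : ℝ → ℝ} (hr : 0 ≤ r) (hψ : Monotone ψ) (hf : Continuous f) (w : X) :
    ballOsc r (fun x => ψ (f x)) w ≤ ψ (ballSup r f w) - ψ (ballInf r f w) :=
  sub_le_sub (ballSup_le hr fun _ hx => hψ (le_ballSup hf hx))
    (le_ballInf hr fun _ hx => hψ (ballInf_le hf hx))

theorem ballSup_mono (hr : 0 ≤ r) (hg : Continuous g) (hfg : ∀ x, f x ≤ g x) (w : X) :
    ballSup r f w ≤ ballSup r g w :=
  ballSup_le hr fun x hx => (hfg x).trans (le_ballSup hg hx)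

theorem ballInf_mono (hr : 0 ≤ r) (hf : Continuous f) (hfg : ∀ x, f x ≤ g x) (w : X) :
    ballInf r f w ≤ ballInf r g w :=
  le_ballInf hr fun x hx => (ballInf_le hf hx).trans (hfg x)

theorem ballSup_max (hr : 0 ≤ r) (hf : Continuous f) (hg : Continuous g) (w : X) :
    ballSup r (fun x => max (f x) (g x)) w = max (ballSup r f w) (ballSup r g w) :=
  le_antisymm
    (ballSup_le hr fun _ hx => max_le_max (le_ballSup hf hx) (le_ballSup hg hx))
    (max_le (ballSup_mono hr (hf.max hg) (fun _ => le_max_left _ _) w)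
      (ballSup_mono hr (hf.max hg) (fun _ => le_max_right _ _) w))

theorem ballInf_min (hr : 0 ≤ r) (hf : Continuous f) (hg : Continuous g) (w : X) :
    ballInf r (fun x => min (f x) (g x)) w = min (ballInf r f w) (ballInf r g w) := by
  simp only [ballInf_eq_neg_ballSup_neg, min_neg_neg]
  rw [← ballSup_max (f := fun x => -f x) (g := fun x => -g x) hr hf.neg hg.neg]
  simp only [max_neg_neg]

theorem ballOsc_min_add_ballOsc_max_le (hr : 0 ≤ r) (hf : Continuous f) (hg : Continuous g)
    (w : X) :
    ballOsc r (fun x => min (f x) (g x)) w + ballOsc r (fun x => max (f x) (g x)) w ≤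
      ballOsc r f w + ballOsc r g w := by
  have hSup : ballSup r (fun x => min (f x) (g x)) w ≤ min (ballSup r f w) (ballSup r g w) :=
    le_min (ballSup_mono hr hf (fun _ => min_le_left _ _) w)
      (ballSup_mono hr hg (fun _ => min_le_right _ _) w)
  have hInf : max (ballInf r f w) (ballInf r g w) ≤ ballInf r (fun x => max (f x) (g x)) w :=
    max_le (ballInf_mono hr hf (fun _ => le_max_left _ _) w)
      (ballInf_mono hr hg (fun _ => le_max_right _ _) w)
  simp only [ballOsc, ballSup_max hr hf hg, ballInf_min hr hf hg]
  linarith [min_add_max (ballSup r f w) (ballSup r g w),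
    min_add_max (ballInf r f w) (ballInf r g w)]

theorem ballOsc_le_add {ε : ℝ} (hr : 0 ≤ r) (hf : Continuous f) (hg : Continuous g)
    (h : ∀ x ∈ closedBall w r, |f x - g x| ≤ ε) : ballOsc r f w ≤ ballOsc r g w + 2 * ε := by
  obtain ⟨x, hx, hfx⟩ := exists_eq_ballSup hr hf w
  obtain ⟨y, hy, hfy⟩ := exists_eq_ballInf hr hf w
  rw [ballOsc, ← hfx, ← hfy]
  linarith [sub_le_ballOsc hg hx hy, (abs_le.1 (h x hx)).2, (abs_le.1 (h y hy)).1]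

end Oscillation

section OscillationNormed

variable {E : Type*} [NormedAddCommGroup E]

theorem continuous_ballSup [ProperSpace E] {f : E → ℝ} (r : ℝ) (hf : Continuous f) :
    Continuous (ballSup r f) := by
  have : ballSup r f = fun w => sSup ((fun x => f (w + x)) '' closedBall 0 r) := by
    ext w
    rw [ballSup, ← image_image f (fun x => w + x), image_add_left,
      preimage_add_closedBall, sub_neg_eq_add, zero_add]
  rw [this]
  exact (isCompact_closedBall 0 r).continuous_sSup (by fun_prop)

theorem continuous_ballOsc [ProperSpace E] {f : E → ℝ} (r : ℝ) (hf : Continuous f) :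
    Continuous (ballOsc r f) := by
  change Continuous fun w => ballSup r f w - ballInf r f w
  simp only [ballInf_eq_neg_ballSup_neg, sub_neg_eq_add]
  exact (continuous_ballSup r hf).add (continuous_ballSup r hf.neg)

variable [NormedSpace ℝ E] [MeasurableSpace E] [OpensMeasurableSpace E]

theorem essSup_restrict_ball_eq {β : Type*} [CompleteLinearOrder β] [TopologicalSpace β]
    [OrderTopology β] [FirstCountableTopology β] {μ : Measure E} [μ.IsOpenPosMeasure]
    {F : E → β} {w x : E} {r : ℝ}
    (hr : r ≠ 0) (hF : Continuous F) (hx : x ∈ closedBall w r)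
    (hmax : ∀ y ∈ closedBall w r, F y ≤ F x) : essSup F (μ.restrict (ball w r)) = F x := by
  refine le_antisymm (essSup_le_of_ae_le _ ?_) (le_of_not_gt fun hlt => ?_)
  · exact ae_restrict_of_forall_mem measurableSet_ball fun y hy => hmax y
      (ball_subset_closedBall hy)
  set a := essSup F (μ.restrict (ball w r))
  have hopen : IsOpen {y | a < F y} := isOpen_lt continuous_const hF
  have hne : ({y | a < F y} ∩ ball w r).Nonempty := by
    rw [← closure_ball w hr] at hx
    exact mem_closure_iff.1 hx _ hopen hlt
  refine ((hopen.inter isOpen_ball).measure_pos μ hne).ne' ?_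
  rw [← Measure.restrict_apply hopen.measurableSet]
  exact meas_essSup_lt

theorem essInf_restrict_ball_eq {β : Type*} [CompleteLinearOrder β] [TopologicalSpace β]
    [OrderTopology β] [FirstCountableTopology β] {μ : Measure E} [μ.IsOpenPosMeasure]
    {F : E → β} {w x : E} {r : ℝ}
    (hr : r ≠ 0) (hF : Continuous F) (hx : x ∈ closedBall w r)
    (hmin : ∀ y ∈ closedBall w r, F x ≤ F y) : essInf F (μ.restrict (ball w r)) = F x :=
  essSup_restrict_ball_eq (β := βᵒᵈ) hr hF hx hmin

end OscillationNormed

theorem essOsc_ball_eq {N : ℕ} {r : ℝ} {f : Space N → ℝ} (hr : 0 < r) (hf : Continuous f)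
    (w : Space N) : essOsc (ball w r) f = ballOsc r f w := by
  obtain ⟨x, hx, hfx⟩ := exists_eq_ballSup hr.le hf w
  obtain ⟨y, hy, hfy⟩ := exists_eq_ballInf hr.le hf w
  have hF : Continuous fun x => (f x : EReal) := continuous_coe_real_ereal.comp hf
  rw [essOsc, essSup_restrict_ball_eq hr.ne' hF hx fun z hz => ?_,
    essInf_restrict_ball_eq hr.ne' hF hy fun z hz => ?_, ballOsc, hfx, hfy, EReal.coe_sub]
  · exact EReal.coe_le_coe_iff.2 (hfy ▸ ballInf_le hf hz)
  · exact EReal.coe_le_coe_iff.2 (hfx ▸ le_ballSup hf hz)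

section WeakMeasurability

theorem exists_countable_isPiSystem_isTopologicalBasis (X : Type*) [TopologicalSpace X]
    [SecondCountableTopology X] :
    ∃ S : Set (Set X), S.Countable ∧ IsPiSystem S ∧ TopologicalSpace.IsTopologicalBasis S := by
  refine ⟨sInter '' {c | c.Finite ∧ c ⊆ TopologicalSpace.countableBasis X},
    (countable_ofPred_finite_subset (TopologicalSpace.countable_countableBasis X)).image _, ?_,
    TopologicalSpace.isTopologicalBasis_of_subbasis
      (TopologicalSpace.eq_generateFrom_countableBasis X)⟩
  rintro _ ⟨c, hc, rfl⟩ _ ⟨d, hd, rfl⟩ -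
  exact ⟨c ∪ d, ⟨hc.1.union hd.1, union_subset hc.2 hd.2⟩, sInter_union c d⟩

variable {α K : Type*} [MeasurableSpace α] {μ : Measure α} [MeasurableSpace K]

theorem aemeasurable_of_isPiSystem {z : α → Measure K} [∀ a, IsFiniteMeasure (z a)]
    {S : Set (Set K)} (hc : S.Countable) (hgen : ‹MeasurableSpace K› = .generateFrom S)
    (hpi : IsPiSystem S) (hS : ∀ s ∈ S, AEMeasurable (fun a => z a s) μ)
    (huniv : AEMeasurable (fun a => z a univ) μ) : AEMeasurable z μ := by
  classical
  have hae : ∀ᵐ a ∂μ, (∀ s (hs : s ∈ S), z a s = (hS s hs).mk _ a) ∧ z a univ = huniv.mk _ a :=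
    ((ae_ball_iff hc).2 fun s hs => (hS s hs).ae_eq_mk).and huniv.ae_eq_mk
  obtain ⟨A, hA, hAm, hAz⟩ := hae.exists_measurable_mem
  refine ⟨A.piecewise z 0, ?_, by filter_upwards [hA] with a ha using by simp [ha]⟩
  have (a : α) : IsFiniteMeasure (A.piecewise z 0 a) := by
    by_cases ha : a ∈ A
    · simpa [ha] using inferInstanceAs (IsFiniteMeasure (z a))
    · simpa [ha] using inferInstanceAs (IsFiniteMeasure (0 : Measure K))
  have hpiece {s : Set K} {f : α → ℝ≥0∞} (hf : Measurable f) (h : ∀ a ∈ A, z a s = f a) :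
      Measurable fun a => A.piecewise z 0 a s := by
    convert! hf.indicator hAm using 2 with a
    by_cases ha : a ∈ A <;> simp [ha, h]
  exact .measure_of_isPiSystem hgen hpi
    (fun s hs => hpiece (hS s hs).measurable_mk fun a ha => (hAz a ha).1 s hs)
    (hpiece huniv.measurable_mk fun a ha => (hAz a ha).2)

variable [PseudoMetricSpace K] [BorelSpace K]

theorem aemeasurable_measure_isClosed {z : α → Measure K} [∀ a, IsFiniteMeasure (z a)]
    (hz : ∀ f : C(K, ℝ), AEMeasurable (fun a => ∫ p, f p ∂z a) μ) {F : Set K} (hF : IsClosed F) :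
    AEMeasurable (fun a => z a F) μ := by
  obtain ⟨δ, -, hδ, hδ₀⟩ := exists_seq_strictAnti_tendsto (0 : ℝ)
  refine aemeasurable_of_tendsto_metrizable_ae atTop (fun n => ?_) (Eventually.of_forall fun a =>
    tendsto_lintegral_thickenedIndicator_of_isClosed (z a) hF hδ hδ₀)
  let f : C(K, ℝ) := ⟨fun p => thickenedIndicator (hδ n) F p,
    NNReal.continuous_coe.comp (thickenedIndicator (hδ n) F).continuous⟩
  have hf (a : α) : ∫⁻ p, thickenedIndicator (hδ n) F p ∂z a = ENNReal.ofReal (∫ p, f p ∂z a) := by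
    rw [lintegral_coe_eq_integral _ (integrable_thickenedIndicator F (hδ n))]
    rfl
  simp only [hf]
  exact (hz f).ennreal_ofReal

theorem aemeasurable_of_forall_integral [SecondCountableTopology K] {z : α → Measure K}
    [∀ a, IsFiniteMeasure (z a)] (hz : ∀ f : C(K, ℝ), AEMeasurable (fun a => ∫ p, f p ∂z a) μ) :
    AEMeasurable z μ := by
  have huniv : AEMeasurable (fun a => z a univ) μ := aemeasurable_measure_isClosed hz isClosed_univ
  obtain ⟨S, hSc, hSpi, hSb⟩ := exists_countable_isPiSystem_isTopologicalBasis K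
  have hSgen : ‹MeasurableSpace K› = .generateFrom S := by
    rw [BorelSpace.measurable_eq (α := K), hSb.borel_eq_generateFrom]
  refine aemeasurable_of_isPiSystem hSc hSgen hSpi (fun U hU => ?_) huniv
  have hUo := hSb.isOpen hU
  have (a : α) : z a U = z a univ - z a Uᶜ := by
    rw [← measure_compl hUo.measurableSet.compl (measure_ne_top _ _), compl_compl]
  simp only [this]
  exact huniv.sub (aemeasurable_measure_isClosed hz hUo.isClosed_compl)

omit [PseudoMetricSpace K] [BorelSpace K] in
theorem exists_kernel_ae_eq {z : α → Measure K} (hz : AEMeasurable z μ) {c : ℝ≥0∞}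
    (hc : ∀ᵐ a ∂μ, z a univ ≤ c) :
    ∃ κ : Kernel α K, (∀ a, κ a univ ≤ c) ∧ ∀ᵐ a ∂μ, κ a = z a := by
  classical
  let A : Set α := {a | hz.mk z a univ ≤ c}
  have hA : MeasurableSet A :=
    measurableSet_le ((Measure.measurable_coe .univ).comp hz.measurable_mk) measurable_const
  refine ⟨⟨A.piecewise (hz.mk z) 0, hz.measurable_mk.piecewise hA measurable_const⟩,
    fun a => ?_, ?_⟩
  · by_cases ha : a ∈ A
    · have hmk : hz.mk z a univ ≤ c := ha
      simpa [ha] using! hmk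
    · simp [ha]
  · filter_upwards [hc, hz.ae_eq_mk] with a hca haz
    have : a ∈ A := by simpa [A, ← haz]
    simp [this, haz]

end WeakMeasurability

section Sweep

variable {E K : Type*} [NormedAddCommGroup E] [ProperSpace E] [MeasurableSpace E] [BorelSpace E]
  [MeasurableSpace K] {μ : Measure E} {κ : Kernel E K} {ζ : K → E} {r : ℝ}

/-- The distribution of `w + ζ p` when `w` has distribution `μ` and `p` has conditional
distribution `κ w`. -/
def sweep (μ : Measure E) (κ : Kernel E K) (ζ : K → E) : Measure E :=
  (μ ⊗ₘ κ).map fun q => q.1 + ζ q.2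

variable [IsFiniteKernel κ] [IsFiniteMeasureOnCompacts μ]

theorem isFiniteMeasureOnCompacts_sweep (hζ : Measurable ζ) (hr : ∀ p, ‖ζ p‖ ≤ r) :
    IsFiniteMeasureOnCompacts (sweep μ κ ζ) where
  lt_top_of_isCompact := by
    intro C hC
    obtain ⟨R, hR⟩ := hC.isBounded.subset_closedBall (0 : E)
    have hm : Measurable fun q : E × K => q.1 + ζ q.2 := by fun_prop
    refine (measure_mono hR).trans_lt ?_
    rw [sweep, Measure.map_apply hm measurableSet_closedBall]
    refine (measure_mono (t := closedBall 0 (R + r) ×ˢ univ) ?_).trans_lt ?_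
    · rintro ⟨w, p⟩ hq
      have := norm_sub_le (w + ζ p) (ζ p)
      rw [mem_preimage, mem_closedBall_zero_iff] at hq
      rw [add_sub_cancel_right] at this
      exact ⟨mem_closedBall_zero_iff.2 (by linarith [hr p]), mem_univ p⟩
    · rw [Measure.compProd_apply_prod measurableSet_closedBall .univ]
      refine (lintegral_mono fun w => κ.measure_le_bound w univ).trans_lt ?_
      rw [setLIntegral_const]
      exact ENNReal.mul_lt_top κ.bound_lt_top measure_closedBall_lt_top

/-- Functions that every Radon measure integrates, such as continuous functions with compact
support and indicators of bounded Borel sets. -/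
def IsTestFunction (φ : E → ℝ) : Prop :=
  ∀ (ν : Measure E) [IsFiniteMeasureOnCompacts ν], Integrable φ ν

omit [ProperSpace E] in
theorem isTestFunction_of_hasCompactSupport {φ : E → ℝ} (hφ : Continuous φ)
    (hc : HasCompactSupport φ) : IsTestFunction φ :=
  fun _ _ => hφ.integrable_of_hasCompactSupport hc

omit [BorelSpace E] in
theorem isTestFunction_indicator {s : Set E} (hs : MeasurableSet s) (hb : Bornology.IsBounded s)
    (c : ℝ) : IsTestFunction (s.indicator fun _ => c) :=
  fun _ _ => (integrable_indicator_iff hs).2 (integrableOn_const hb.measure_lt_top.ne)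

theorem integrable_comp_add (hζ : Measurable ζ) (hr : ∀ p, ‖ζ p‖ ≤ r) {φ : E → ℝ}
    (hφ : IsTestFunction φ) : Integrable (fun q : E × K => φ (q.1 + ζ q.2)) (μ ⊗ₘ κ) := by
  have := isFiniteMeasureOnCompacts_sweep (μ := μ) (κ := κ) hζ hr
  have hint := hφ (sweep μ κ ζ)
  exact (integrable_map_measure hint.1 (by fun_prop)).1 hint

theorem integral_sweep (hζ : Measurable ζ) (hr : ∀ p, ‖ζ p‖ ≤ r) {φ : E → ℝ}
    (hφ : IsTestFunction φ) : ∫ x, φ x ∂sweep μ κ ζ = ∫ w, ∫ p, φ (w + ζ p) ∂κ w ∂μ := by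
  have := isFiniteMeasureOnCompacts_sweep (μ := μ) (κ := κ) hζ hr
  rw [sweep, integral_map (by fun_prop) (hφ (sweep μ κ ζ)).1,
    Measure.integral_compProd (integrable_comp_add hζ hr hφ)]

end Sweep

section Pairs

variable {N : ℕ} {r : ℝ} {φ ψ u : Space N → ℝ} {w : Space N}

instance instCompactSpaceBallPair : CompactSpace (ballPair N r) :=
  isCompact_iff_compactSpace.1 ((isCompact_closedBall 0 r).prod (isCompact_closedBall 0 r))

/-- The integrand `φ (w + x) - φ (w + y)` of `fieldAction`, as a function of the pair
`(x, y) ∈ C_r`. -/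
def pairDiff (φ : Space N → ℝ) (w : Space N) (p : ballPair N r) : ℝ :=
  φ (w + p.1.1) - φ (w + p.1.2)

theorem add_fst_mem_closedBall (w : Space N) (p : ballPair N r) : w + p.1.1 ∈ closedBall w r := by
  simpa [mem_closedBall, dist_eq_norm] using! p.2.1

theorem add_snd_mem_closedBall (w : Space N) (p : ballPair N r) : w + p.1.2 ∈ closedBall w r := by
  simpa [mem_closedBall, dist_eq_norm] using! p.2.2

theorem norm_fst_le (p : ballPair N r) : ‖p.1.1‖ ≤ r := mem_closedBall_zero_iff.1 p.2.1

theorem norm_snd_le (p : ballPair N r) : ‖p.1.2‖ ≤ r := mem_closedBall_zero_iff.1 p.2.2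

theorem continuous_pairDiff (hφ : Continuous φ) :
    Continuous fun q : Space N × ballPair N r => pairDiff φ q.1 q.2 := by
  unfold pairDiff
  fun_prop

theorem continuous_pairDiff_right (hφ : Continuous φ) (w : Space N) :
    Continuous (pairDiff (r := r) φ w) :=
  (continuous_pairDiff hφ).comp (Continuous.prodMk_right w)

theorem pairDiff_le_ballOsc (hφ : Continuous φ) (w : Space N) (p : ballPair N r) :
    pairDiff φ w p ≤ ballOsc r φ w :=
  sub_le_ballOsc hφ (add_fst_mem_closedBall w p) (add_snd_mem_closedBall w p)

theorem integrable_pairDiff {μ : Measure (ballPair N r)} [IsFiniteMeasure μ] (hφ : Continuous φ)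
    (w : Space N) : Integrable (pairDiff φ w) μ :=
  (continuous_pairDiff_right hφ w).integrable_of_hasCompactSupport (.of_compactSpace _)

theorem integral_pairDiff_sub {μ : Measure (ballPair N r)} [IsFiniteMeasure μ] (hφ : Continuous φ)
    (hψ : Continuous ψ) (w : Space N) :
    ∫ p, pairDiff (fun x => φ x - ψ x) w p ∂μ =
      ∫ p, pairDiff φ w p ∂μ - ∫ p, pairDiff ψ w p ∂μ := by
  rw [← integral_sub (integrable_pairDiff hφ w) (integrable_pairDiff hψ w)]
  simp only [pairDiff, sub_sub_sub_comm]

theorem integral_pairDiff_le_ballOsc {μ : Measure (ballPair N r)} (hr : 0 ≤ r) (hμ : μ univ ≤ 1)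
    (hφ : Continuous φ) (w : Space N) : ∫ p, pairDiff φ w p ∂μ ≤ ballOsc r φ w := by
  have : IsFiniteMeasure μ := ⟨hμ.trans_lt ENNReal.one_lt_top⟩
  calc ∫ p, pairDiff φ w p ∂μ ≤ ∫ _, ballOsc r φ w ∂μ :=
        integral_mono (integrable_pairDiff hφ w) (integrable_const _) (pairDiff_le_ballOsc hφ w)
    _ = μ.real univ * ballOsc r φ w := by rw [integral_const, smul_eq_mul]
    _ ≤ ballOsc r φ w := mul_le_of_le_one_left (ballOsc_nonneg hr hφ w)
        (ENNReal.toReal_mono ENNReal.one_ne_top hμ)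

theorem measure_univ_eq_one_of_integral_pairDiff_eq {μ : Measure (ballPair N r)}
    (hμ : μ univ ≤ 1) (hu : Continuous u)
    (h : ∫ p, pairDiff u w p ∂μ = ballOsc r u w) (hosc : 0 < ballOsc r u w) : μ univ = 1 := by
  have : IsFiniteMeasure μ := ⟨hμ.trans_lt ENNReal.one_lt_top⟩
  refine le_antisymm hμ ?_
  have hle : ∫ p, pairDiff u w p ∂μ ≤ ∫ _, ballOsc r u w ∂μ :=
    integral_mono (integrable_pairDiff hu w) (integrable_const _) (pairDiff_le_ballOsc hu w)
  rw [h, integral_const, smul_eq_mul, le_mul_iff_one_le_left hosc] at hle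
  simpa using ENNReal.ofReal_le_ofReal hle |>.trans_eq (ofReal_measureReal)

theorem ae_eq_ballSup_and_eq_ballInf {μ : Measure (ballPair N r)} (hr : 0 ≤ r) (hμ : μ univ ≤ 1)
    (hu : Continuous u) (h : ∫ p, pairDiff u w p ∂μ = ballOsc r u w) :
    ∀ᵐ p ∂μ, u (w + p.1.1) = ballSup r u w ∧ u (w + p.1.2) = ballInf r u w := by
  have : IsFiniteMeasure μ := ⟨hμ.trans_lt ENNReal.one_lt_top⟩
  have hint : Integrable (fun p => ballOsc r u w - pairDiff u w p) μ :=
    (integrable_const _).sub (integrable_pairDiff hu w)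
  have hnonneg : 0 ≤ fun p : ballPair N r => ballOsc r u w - pairDiff u w p :=
    fun p => sub_nonneg.2 (pairDiff_le_ballOsc hu w p)
  have hzero : ∫ p, (ballOsc r u w - pairDiff u w p) ∂μ = 0 := by
    refine le_antisymm ?_ (integral_nonneg hnonneg)
    rw [integral_sub (integrable_const _) (integrable_pairDiff hu w), h, integral_const,
      smul_eq_mul, sub_nonpos]
    exact mul_le_of_le_one_left (ballOsc_nonneg hr hu w)
      (ENNReal.toReal_mono ENNReal.one_ne_top hμ)
  filter_upwards [(integral_eq_zero_iff_of_nonneg hnonneg hint).1 hzero] with p hp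
  have hsup := le_ballSup hu (add_fst_mem_closedBall w p)
  have hinf := ballInf_le hu (add_snd_mem_closedBall w p)
  simp only [Pi.zero_apply, ballOsc, pairDiff] at hp
  constructor <;> linarith

theorem integral_pairDiff_comp {μ : Measure (ballPair N r)} (hr : 0 ≤ r) (hμ : μ univ ≤ 1)
    (hu : Continuous u) (h : ∫ p, pairDiff u w p ∂μ = ballOsc r u w) (χ : ℝ → ℝ) :
    ∫ p, pairDiff (fun x => χ (u x)) w p ∂μ = χ (ballSup r u w) - χ (ballInf r u w) := by
  have hae : (pairDiff (fun x => χ (u x)) w) =ᵐ[μ]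
      fun _ => χ (ballSup r u w) - χ (ballInf r u w) := by
    filter_upwards [ae_eq_ballSup_and_eq_ballInf hr hμ hu h] with p hp
    rw [pairDiff, hp.1, hp.2]
  rw [integral_congr_ae hae, integral_const]
  rcases (ballOsc_nonneg hr hu w).eq_or_lt with hosc | hosc
  · rw [sub_eq_zero.1 hosc.symm]
    simp
  · simp [measureReal_def, measure_univ_eq_one_of_integral_pairDiff_eq hμ hu h hosc]

end Pairs

section CalibratingKernel

variable {N : ℕ} {r h : ℝ} {g u φ : Space N → ℝ} {κ : Kernel (Space N) (ballPair N r)}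

/-- The Euler–Lagrange system of `IsSolution` for an everywhere defined Borel field: the measure
`κ w` plays the role of the Cahn–Hoffman field `z_w` of `u`, and the equation
`-h Div^r κ = g - u` is tested against continuous compactly supported functions. -/
structure IsCalibratingKernel (r h : ℝ) (g u : Space N → ℝ) (κ : Kernel (Space N) (ballPair N r)) :
    Prop where
  mass_le_one : ∀ w, κ w univ ≤ 1
  integral_pairDiff : ∀ᵐ w, ∫ p, pairDiff u w p ∂κ w = ballOsc r u w
  equation : ∀ φ : Space N → ℝ, Continuous φ → HasCompactSupport φ →
    h / (2 * r) * ∫ w, ∫ p, pairDiff φ w p ∂κ w = ∫ w, φ w * (g w - u w)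

theorem IsCalibratingKernel.isFiniteKernel (hκ : IsCalibratingKernel r h g u κ) :
    IsFiniteKernel κ :=
  ⟨1, ENNReal.one_lt_top, hκ.mass_le_one⟩

theorem integrable_pairDiff_compProd [IsFiniteKernel κ] (hφ : IsTestFunction φ) :
    Integrable (fun q : Space N × ballPair N r => pairDiff φ q.1 q.2) (volume ⊗ₘ κ) :=
  (integrable_comp_add (by fun_prop) norm_fst_le hφ).sub
    (integrable_comp_add (by fun_prop) norm_snd_le hφ)

theorem integrable_integral_pairDiff [IsFiniteKernel κ] (hφ : IsTestFunction φ) :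
    Integrable fun w => ∫ p, pairDiff φ w p ∂κ w :=
  Integrable.integral_compProd (integrable_pairDiff_compProd hφ)

theorem integral_integral_pairDiff [IsFiniteKernel κ] (hφ : IsTestFunction φ) :
    ∫ w, ∫ p, pairDiff φ w p ∂κ w =
      ∫ x, φ x ∂sweep volume κ (fun p => p.1.1) - ∫ x, φ x ∂sweep volume κ (fun p => p.1.2) := by
  have h₁ := integrable_comp_add (μ := volume) (κ := κ) (by fun_prop) norm_fst_le hφ
  have h₂ := integrable_comp_add (μ := volume) (κ := κ) (by fun_prop) norm_snd_le hφ
  rw [← Measure.integral_compProd (integrable_pairDiff_compProd hφ)]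
  simp only [pairDiff]
  rw [integral_sub h₁ h₂, Measure.integral_compProd h₁, Measure.integral_compProd h₂,
    integral_sweep (by fun_prop) norm_fst_le hφ, integral_sweep (by fun_prop) norm_snd_le hφ]

theorem integral_mul_sub_eq (hφ : Continuous φ) (hc : HasCompactSupport φ) (hg : Continuous g)
    (hu : Continuous u) :
    ∫ w, φ w * (g w - u w) = (∫ w, φ w * g w) - ∫ w, φ w * u w := by
  have hint {v : Space N → ℝ} (hv : Continuous v) : Integrable fun w => φ w * v w :=
    (hφ.mul hv).integrable_of_hasCompactSupport hc.mul_right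
  simp only [mul_sub, integral_sub (hint hg) (hint hu)]

theorem solvesEquation_iff {z : Space N → FiniteMeasure (ballPair N r)} (hg : Continuous g)
    (hu : Continuous u) :
    SolvesEquation r h g u z ↔ ∀ φ : Space N → ℝ, Continuous φ → HasCompactSupport φ →
      h / (2 * r) * ∫ w, ∫ p, pairDiff φ w p ∂(z w : Measure (ballPair N r)) =
        ∫ w, φ w * (g w - u w) := by
  refine forall₃_congr fun φ hφ hc => ?_
  have hdiv : -h * nonlocalDiv r z φ =
      h / (2 * r) * ∫ w, ∫ p, pairDiff φ w p ∂(z w : Measure (ballPair N r)) := by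
    simp only [nonlocalDiv, fieldAction, pairDiff]
    ring
  rw [integral_mul_sub_eq hφ hc hg hu, eq_sub_iff_add_eq, hdiv]

theorem isSolution_iff_exists_isCalibratingKernel (hr : 0 < r) (hg : Continuous g)
    (hu : Continuous u) : IsSolution r h g u ↔ ∃ κ, IsCalibratingKernel r h g u κ := by
  constructor
  · rintro ⟨z, ⟨⟨hz, -⟩, hae⟩, heq⟩
    rw [solvesEquation_iff hg hu] at heq
    obtain ⟨κ, hκ, hκz⟩ := exists_kernel_ae_eq (aemeasurable_of_forall_integral hz) (c := 1) <| by
      filter_upwards [hae] with w hw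
      rw [← FiniteMeasure.ennreal_mass]
      exact_mod_cast hw.1
    refine ⟨κ, hκ, ?_, fun φ hφ hc => ?_⟩
    · filter_upwards [hae, hκz] with w hw hκw
      rw [hκw]
      exact EReal.coe_injective (hw.2.trans (essOsc_ball_eq hr hu w))
    · rw [← heq φ hφ hc]
      congr 1
      refine integral_congr_ae ?_
      filter_upwards [hκz] with w hκw
      rw [hκw]
  · rintro ⟨κ, hκ⟩
    have := hκ.isFiniteKernel
    let z (w : Space N) : FiniteMeasure (ballPair N r) := ⟨κ w, inferInstance⟩
    have hmass (w : Space N) : (z w).mass ≤ 1 := by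
      rw [← ENNReal.coe_le_coe, FiniteMeasure.ennreal_mass]
      exact hκ.mass_le_one w
    refine ⟨z, ⟨⟨fun f => ?_, ?_⟩, ?_⟩, (solvesEquation_iff hg hu).2 hκ.equation⟩
    · exact (f.continuous.comp continuous_snd).stronglyMeasurable.integral_kernel_prod_right'
        |>.measurable.aemeasurable
    · refine memLp_top_of_bound (C := 1) ?_ (Eventually.of_forall fun w => ?_)
      · exact (κ.measurable_coe .univ).ennreal_toReal.aestronglyMeasurable
      · rw [Real.norm_of_nonneg (NNReal.coe_nonneg _)]
        exact_mod_cast hmass w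
    · filter_upwards [hκ.integral_pairDiff] with w hw
      exact ⟨hmass w, by rw [essOsc_ball_eq hr hu w, ← hw]; rfl⟩

end CalibratingKernel

section Comparison

variable {N : ℕ} {r h : ℝ} {g g₁ g₂ u₁ u₂ : Space N → ℝ}

/- The submodularity of the oscillation, applied to the test function
`max (ψ u₁) (ψ u₂) - ψ u₂ = ψ u₁ - min (ψ u₁) (ψ u₂)`, orders the actions of the two fields. -/
theorem integral_pairDiff_max_sub_le {μ₁ μ₂ : Measure (ballPair N r)} (hr : 0 ≤ r)
    (hμ₁ : μ₁ univ ≤ 1) (hμ₂ : μ₂ univ ≤ 1) (hu₁ : Continuous u₁) (hu₂ : Continuous u₂)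
    {w : Space N} (h₁ : ∫ p, pairDiff u₁ w p ∂μ₁ = ballOsc r u₁ w)
    (h₂ : ∫ p, pairDiff u₂ w p ∂μ₂ = ballOsc r u₂ w) {ψ : ℝ → ℝ} (hψ : Continuous ψ)
    (hm : Monotone ψ) :
    ∫ p, pairDiff (fun x => max (ψ (u₁ x)) (ψ (u₂ x)) - ψ (u₂ x)) w p ∂μ₂ ≤
      ∫ p, pairDiff (fun x => max (ψ (u₁ x)) (ψ (u₂ x)) - ψ (u₂ x)) w p ∂μ₁ := by
  have : IsFiniteMeasure μ₁ := ⟨hμ₁.trans_lt ENNReal.one_lt_top⟩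
  have : IsFiniteMeasure μ₂ := ⟨hμ₂.trans_lt ENNReal.one_lt_top⟩
  have ha : Continuous fun x => ψ (u₁ x) := hψ.comp hu₁
  have hb : Continuous fun x => ψ (u₂ x) := hψ.comp hu₂
  have hmin : (fun x => max (ψ (u₁ x)) (ψ (u₂ x)) - ψ (u₂ x)) =
      fun x => ψ (u₁ x) - min (ψ (u₁ x)) (ψ (u₂ x)) :=
    funext fun x => by linarith [min_add_max (ψ (u₁ x)) (ψ (u₂ x))]
  rw [integral_pairDiff_sub (ha.max hb) hb, integral_pairDiff_comp hr hμ₂ hu₂ h₂, hmin,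
    integral_pairDiff_sub ha (ha.min hb), integral_pairDiff_comp hr hμ₁ hu₁ h₁]
  linarith [integral_pairDiff_le_ballOsc hr hμ₁ (ha.min hb) w,
    integral_pairDiff_le_ballOsc hr hμ₂ (ha.max hb) w, ballOsc_min_add_ballOsc_max_le hr ha hb w,
    ballOsc_comp_le hr hm hu₁ w, ballOsc_comp_le hr hm hu₂ w]

theorem integral_max_sub_mul_le {κ₁ κ₂ : Kernel (Space N) (ballPair N r)} (hr : 0 < r)
    (hh : 0 < h) (hu₁ : Continuous u₁) (hu₂ : Continuous u₂)
    (hκ₁ : IsCalibratingKernel r h g₁ u₁ κ₁) (hκ₂ : IsCalibratingKernel r h g₂ u₂ κ₂)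
    {ψ : ℝ → ℝ} (hψ : Continuous ψ) (hm : Monotone ψ)
    (hc : HasCompactSupport fun x => max (ψ (u₁ x)) (ψ (u₂ x)) - ψ (u₂ x)) :
    ∫ x, (max (ψ (u₁ x)) (ψ (u₂ x)) - ψ (u₂ x)) * (g₂ x - u₂ x) ≤
      ∫ x, (max (ψ (u₁ x)) (ψ (u₂ x)) - ψ (u₂ x)) * (g₁ x - u₁ x) := by
  have := hκ₁.isFiniteKernel
  have := hκ₂.isFiniteKernel
  have hφ : Continuous fun x => max (ψ (u₁ x)) (ψ (u₂ x)) - ψ (u₂ x) := by fun_prop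
  have htest := isTestFunction_of_hasCompactSupport hφ hc
  rw [← hκ₁.equation _ hφ hc, ← hκ₂.equation _ hφ hc]
  refine mul_le_mul_of_nonneg_left (integral_mono_ae (integrable_integral_pairDiff htest)
    (integrable_integral_pairDiff htest) ?_) (by positivity)
  filter_upwards [hκ₁.integral_pairDiff, hκ₂.integral_pairDiff] with x h₁ h₂
  exact integral_pairDiff_max_sub_le hr.le (hκ₁.mass_le_one x) (hκ₂.mass_le_one x) hu₁ hu₂ h₁ h₂
    hψ hm

theorem comp_le_comp_of_isSolution (hr : 0 < r) (hh : 0 < h) (hg₁ : Continuous g₁)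
    (hg₂ : Continuous g₂) (hu₁ : Continuous u₁) (hu₂ : Continuous u₂)
    (hs₁ : IsSolution r h g₁ u₁) (hs₂ : IsSolution r h g₂ u₂) (hg : ∀ w, g₁ w ≤ g₂ w)
    {ψ : ℝ → ℝ} (hψ : Continuous ψ) (hm : Monotone ψ)
    (hle : ∀ᶠ x in cocompact (Space N), ψ (u₁ x) ≤ ψ (u₂ x)) (w : Space N) :
    ψ (u₁ w) ≤ ψ (u₂ w) := by
  obtain ⟨κ₁, hκ₁⟩ := (isSolution_iff_exists_isCalibratingKernel hr hg₁ hu₁).1 hs₁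
  obtain ⟨κ₂, hκ₂⟩ := (isSolution_iff_exists_isCalibratingKernel hr hg₂ hu₂).1 hs₂
  set φ : Space N → ℝ := fun x => max (ψ (u₁ x)) (ψ (u₂ x)) - ψ (u₂ x) with hφ_def
  have hφ : Continuous φ := by fun_prop
  have hφ_zero {x : Space N} (hx : ψ (u₁ x) ≤ ψ (u₂ x)) : φ x = 0 := by
    simp only [hφ_def, max_eq_right hx, sub_self]
  have hφ_pos {x : Space N} (hx : ψ (u₂ x) < ψ (u₁ x)) : 0 < φ x := by
    simpa only [hφ_def, max_eq_left hx.le, sub_pos] using hx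
  have hc : HasCompactSupport φ := hasCompactSupport_iff_eventuallyEq.2 <| by
    rw [coclosedCompact_eq_cocompact]
    exact hle.mono fun _ => hφ_zero
  let d (x : Space N) : ℝ := (g₂ x - u₂ x) - (g₁ x - u₁ x)
  have hd_pos {x : Space N} (hx : ψ (u₂ x) < ψ (u₁ x)) : 0 < d x := by
    simp only [d]
    linarith [hg x, hm.reflect_lt hx]
  have hnonneg (x : Space N) : 0 ≤ φ x * d x := by
    rcases le_or_gt (ψ (u₁ x)) (ψ (u₂ x)) with hx | hx
    · rw [hφ_zero hx, zero_mul]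
    · exact (mul_pos (hφ_pos hx) (hd_pos hx)).le
  have hint : ∫ x, φ x * d x ≤ 0 := by
    have hsplit : ∫ x, φ x * d x = (∫ x, φ x * (g₂ x - u₂ x)) - ∫ x, φ x * (g₁ x - u₁ x) :=
      integral_mul_sub_eq hφ hc (hg₂.sub hu₂) (hg₁.sub hu₁)
    rw [hsplit, sub_nonpos]
    exact integral_max_sub_mul_le hr hh hu₁ hu₂ hκ₁ hκ₂ hψ hm hc
  by_contra! hw
  exact hint.not_gt <| Continuous.integral_pos_of_hasCompactSupport_nonneg_nonzero (by fun_prop)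
    hc.mul_right hnonneg (mul_pos (hφ_pos hw) (hd_pos hw)).ne'

theorem le_of_isSolution_of_tendsto_atTop (hr : 0 < r) (hh : 0 < h) (hg₁ : Continuous g₁)
    (hg₂ : Continuous g₂) (hu₁ : Continuous u₁) (hu₂ : Continuous u₂)
    (hs₁ : IsSolution r h g₁ u₁) (hs₂ : IsSolution r h g₂ u₂) (hg : ∀ w, g₁ w ≤ g₂ w)
    (ht : Tendsto u₂ (cocompact (Space N)) atTop) (w : Space N) : u₁ w ≤ u₂ w := by
  have hmin := comp_le_comp_of_isSolution hr hh hg₁ hg₂ hu₁ hu₂ hs₁ hs₂ hg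
    (ψ := fun s => min s (u₁ w)) (by fun_prop) (fun _ _ hst => min_le_min_right _ hst)
    (by filter_upwards [ht.eventually_ge_atTop (u₁ w)] with x hx using by simp [hx]) w
  simpa using hmin

theorem le_of_isSolution_of_tendsto_atBot (hr : 0 < r) (hh : 0 < h) (hg₁ : Continuous g₁)
    (hg₂ : Continuous g₂) (hu₁ : Continuous u₁) (hu₂ : Continuous u₂)
    (hs₁ : IsSolution r h g₁ u₁) (hs₂ : IsSolution r h g₂ u₂) (hg : ∀ w, g₁ w ≤ g₂ w)
    (ht : Tendsto u₁ (cocompact (Space N)) atBot) (w : Space N) : u₁ w ≤ u₂ w := by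
  have hmax := comp_le_comp_of_isSolution hr hh hg₁ hg₂ hu₁ hu₂ hs₁ hs₂ hg
    (ψ := fun s => max s (u₂ w)) (by fun_prop) (fun _ _ hst => max_le_max_right _ hst)
    (by filter_upwards [ht.eventually_le_atBot (u₂ w)] with x hx using by simp [hx]) w
  simpa using hmax

theorem continuous_of_mem_lipPlus (hg : g ∈ LipPlus N) : Continuous g :=
  hg.1.choose_spec.continuous

theorem continuous_of_mem_lipMinus (hg : g ∈ LipMinus N) : Continuous g :=
  hg.1.choose_spec.continuous

theorem neg_mem_lipPlus (hg : g ∈ LipMinus N) : (fun x => -g x) ∈ LipPlus N :=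
  ⟨⟨_, hg.1.choose_spec.neg⟩, tendsto_neg_atBot_atTop.comp hg.2⟩

theorem cocompact_eq_bot_of_lipPlus_le_lipMinus (hg₁ : g₁ ∈ LipPlus N) (hg₂ : g₂ ∈ LipMinus N)
    (hg : ∀ w, g₁ w ≤ g₂ w) : cocompact (Space N) = ⊥ := by
  by_contra hne
  have : (cocompact (Space N)).NeBot := ⟨hne⟩
  obtain ⟨x, hx₁, hx₂⟩ :=
    ((hg₁.2.eventually_gt_atTop 0).and (hg₂.2.eventually_lt_atBot 0)).exists
  linarith [hg x]

theorem le_of_isSolution (hr : 0 < r) (hh : 0 < h)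
    (h₁ : (g₁ ∈ LipPlus N ∧ u₁ ∈ LipPlus N) ∨ (g₁ ∈ LipMinus N ∧ u₁ ∈ LipMinus N))
    (h₂ : (g₂ ∈ LipPlus N ∧ u₂ ∈ LipPlus N) ∨ (g₂ ∈ LipMinus N ∧ u₂ ∈ LipMinus N))
    (hs₁ : IsSolution r h g₁ u₁) (hs₂ : IsSolution r h g₂ u₂) (hg : ∀ w, g₁ w ≤ g₂ w)
    (w : Space N) : u₁ w ≤ u₂ w := by
  have hcont {g u : Space N → ℝ}
      (hgu : (g ∈ LipPlus N ∧ u ∈ LipPlus N) ∨ (g ∈ LipMinus N ∧ u ∈ LipMinus N)) :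
      Continuous g ∧ Continuous u :=
    hgu.elim (fun H => ⟨continuous_of_mem_lipPlus H.1, continuous_of_mem_lipPlus H.2⟩)
      fun H => ⟨continuous_of_mem_lipMinus H.1, continuous_of_mem_lipMinus H.2⟩
  have hTop := le_of_isSolution_of_tendsto_atTop hr hh (hcont h₁).1 (hcont h₂).1 (hcont h₁).2
    (hcont h₂).2 hs₁ hs₂ hg
  rcases h₂ with ⟨-, hu₂⟩ | ⟨hg₂, hu₂⟩
  · exact hTop hu₂.2 w
  rcases h₁ with ⟨hg₁, -⟩ | ⟨hg₁, hu₁⟩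
  · exact hTop (cocompact_eq_bot_of_lipPlus_le_lipMinus hg₁ hg₂ hg ▸ tendsto_bot) w
  · exact le_of_isSolution_of_tendsto_atBot hr hh (continuous_of_mem_lipMinus hg₁)
      (continuous_of_mem_lipMinus hg₂) (continuous_of_mem_lipMinus hu₁)
      (continuous_of_mem_lipMinus hu₂) hs₁ hs₂ hg hu₁.2 w

end Comparison

section Reflection

variable {N : ℕ} {r h : ℝ} {g u : Space N → ℝ} {κ : Kernel (Space N) (ballPair N r)}

/-- The reflection `(x, y) ↦ (y, x)` of the pairs in `C_r`. -/
def swapPair (p : ballPair N r) : ballPair N r := ⟨p.1.swap, p.2.2, p.2.1⟩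

theorem measurable_swapPair : Measurable (swapPair : ballPair N r → ballPair N r) :=
  (measurable_swap.comp measurable_subtype_coe).subtype_mk

theorem pairDiff_swapPair (φ : Space N → ℝ) (w : Space N) (p : ballPair N r) :
    pairDiff φ w (swapPair p) = -pairDiff φ w p :=
  (neg_sub _ _).symm

theorem integral_pairDiff_map_swapPair {φ : Space N → ℝ} (hφ : Continuous φ) (w : Space N) :
    ∫ p, pairDiff φ w p ∂(κ.map swapPair) w = -∫ p, pairDiff φ w p ∂κ w := by
  rw [Kernel.map_apply _ measurable_swapPair, integral_map measurable_swapPair.aemeasurable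
    (continuous_pairDiff_right hφ w).aestronglyMeasurable]
  simp only [pairDiff_swapPair, integral_neg]

theorem IsCalibratingKernel.map_swapPair (hu : Continuous u) (hκ : IsCalibratingKernel r h g u κ) :
    IsCalibratingKernel r h (fun x => -g x) (fun x => -u x) (κ.map swapPair) where
  mass_le_one w := by
    rw [Kernel.map_apply _ measurable_swapPair, Measure.map_apply measurable_swapPair .univ]
    exact hκ.mass_le_one w
  integral_pairDiff := by
    filter_upwards [hκ.integral_pairDiff] with w hw
    rw [integral_pairDiff_map_swapPair (φ := fun x => -u x) hu.neg, ballOsc_neg, ← hw,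
      ← integral_neg]
    simp only [pairDiff, neg_sub_neg, neg_sub]
  equation φ hφ hc := by
    simp only [integral_pairDiff_map_swapPair hφ]
    rw [integral_neg, mul_neg, hκ.equation φ hφ hc, ← integral_neg]
    simp only [neg_sub_neg, ← mul_neg, neg_sub]

theorem IsSolution.neg (hr : 0 < r) (hg : Continuous g) (hu : Continuous u)
    (hs : IsSolution r h g u) : IsSolution r h (fun x => -g x) (fun x => -u x) := by
  obtain ⟨κ, hκ⟩ := (isSolution_iff_exists_isCalibratingKernel hr hg hu).1 hs
  exact (isSolution_iff_exists_isCalibratingKernel hr hg.neg hu.neg).2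
    ⟨_, hκ.map_swapPair hu⟩

end Reflection

section TestFunctions

variable {N : ℕ} {r h : ℝ} {g u φ : Space N → ℝ} {κ : Kernel (Space N) (ballPair N r)}

theorem integral_smul_add_withDensity {c : ℝ} (hc : 0 ≤ c) {ν : Measure (Space N)}
    [IsFiniteMeasureOnCompacts ν] {f : Space N → ℝ} (hf : Continuous f) (hφ : IsTestFunction φ) :
    ∫ x, φ x ∂(ENNReal.ofReal c • ν + volume.withDensity fun x => ENNReal.ofReal (f x)) =
      c * ∫ x, φ x ∂ν + ∫ x, φ x * max (f x) 0 := by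
  have := IsLocallyFiniteMeasure.withDensity_ofReal (μ := (volume : Measure (Space N))) hf
  rw [integral_add_measure ((hφ ν).smul_measure ENNReal.ofReal_ne_top) (hφ _),
    integral_smul_measure, ENNReal.toReal_ofReal hc, smul_eq_mul,
    integral_withDensity_eq_integral_toReal_smul (by fun_prop) (by simp)]
  simp only [ENNReal.toReal_ofReal', smul_eq_mul, mul_comm]

theorem isFiniteMeasureOnCompacts_smul_add_withDensity (c : ℝ) (ν : Measure (Space N))
    [IsFiniteMeasureOnCompacts ν] {f : Space N → ℝ} (hf : Continuous f) :
    IsFiniteMeasureOnCompacts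
      (ENNReal.ofReal c • ν + volume.withDensity fun x => ENNReal.ofReal (f x)) := by
  have := IsLocallyFiniteMeasure.withDensity_ofReal (μ := (volume : Measure (Space N))) hf
  have := IsFiniteMeasureOnCompacts.smul ν (ENNReal.ofReal_ne_top (r := c))
  exact ⟨fun _ hK => ENNReal.add_lt_top.2 ⟨hK.measure_lt_top, hK.measure_lt_top⟩⟩

theorem IsTestFunction.integrable_mul (hφ : IsTestFunction φ) {f : Space N → ℝ}
    (hf : Continuous f) : Integrable fun x => φ x * max (f x) 0 := by
  have := IsLocallyFiniteMeasure.withDensity_ofReal (μ := (volume : Measure (Space N))) hf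
  have hint := hφ (volume.withDensity fun x => ENNReal.ofReal (f x))
  rw [integrable_withDensity_iff_integrable_smul' (by fun_prop) (by simp)] at hint
  simpa only [ENNReal.toReal_ofReal', smul_eq_mul, mul_comm] using! hint

theorem mul_integral_integral_pairDiff_eq_iff [IsFiniteKernel κ] {c : ℝ} (hc : 0 ≤ c)
    {f : Space N → ℝ} (hf : Continuous f) (hφ : IsTestFunction φ) :
    c * ∫ w, ∫ p, pairDiff φ w p ∂κ w = ∫ w, φ w * f w ↔
      ∫ x, φ x ∂(ENNReal.ofReal c • sweep volume κ (fun p => p.1.1) +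
          volume.withDensity fun x => ENNReal.ofReal (-f x)) =
        ∫ x, φ x ∂(ENNReal.ofReal c • sweep volume κ (fun p => p.1.2) +
          volume.withDensity fun x => ENNReal.ofReal (f x)) := by
  have := isFiniteMeasureOnCompacts_sweep (μ := volume) (κ := κ) (by fun_prop) norm_fst_le
  have := isFiniteMeasureOnCompacts_sweep (μ := volume) (κ := κ) (by fun_prop) norm_snd_le
  have hf' : Continuous fun x => -f x := hf.neg
  have hsplit : ∫ x, φ x * f x = (∫ x, φ x * max (f x) 0) - ∫ x, φ x * max (-f x) 0 := by
    rw [← integral_sub (hφ.integrable_mul hf) (hφ.integrable_mul hf')]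
    simp only [← mul_sub, max_zero_sub_max_neg_zero_eq_self]
  rw [integral_smul_add_withDensity hc hf' hφ, integral_smul_add_withDensity hc hf hφ,
    integral_integral_pairDiff hφ, hsplit, mul_sub, sub_eq_sub_iff_add_eq_add,
    add_comm (∫ x, φ x * max (f x) 0)]

theorem IsCalibratingKernel.equation_of_isTestFunction (hκ : IsCalibratingKernel r h g u κ)
    (hr : 0 < r) (hh : 0 < h) (hg : Continuous g) (hu : Continuous u) (hφ : IsTestFunction φ) :
    h / (2 * r) * ∫ w, ∫ p, pairDiff φ w p ∂κ w = ∫ w, φ w * (g w - u w) := by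
  have := hκ.isFiniteKernel
  have hc : 0 ≤ h / (2 * r) := by positivity
  have hf : Continuous fun x => g x - u x := hg.sub hu
  have := isFiniteMeasureOnCompacts_sweep (μ := volume) (κ := κ) (by fun_prop) norm_fst_le
  have := isFiniteMeasureOnCompacts_sweep (μ := volume) (κ := κ) (by fun_prop) norm_snd_le
  have := isFiniteMeasureOnCompacts_smul_add_withDensity (h / (2 * r))
    (sweep volume κ fun p => p.1.1) (f := fun x => -(g x - u x)) hf.neg
  have := isFiniteMeasureOnCompacts_smul_add_withDensity (h / (2 * r))
    (sweep volume κ fun p => p.1.2) hf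
  rw [mul_integral_integral_pairDiff_eq_iff hc hf hφ]
  congr 1
  refine Measure.ext_of_integral_eq_on_compactlySupported fun f => ?_
  exact (mul_integral_integral_pairDiff_eq_iff hc hf
    (isTestFunction_of_hasCompactSupport f.continuous f.hasCompactSupport)).1
    (hκ.equation f f.continuous f.hasCompactSupport)

end TestFunctions

section Thickening

variable {E : Type*} [NormedAddCommGroup E] [NormedSpace ℝ E] [FiniteDimensional ℝ E]
  [MeasurableSpace E] [BorelSpace E] (μ : Measure E) [μ.IsAddHaarMeasure]

/-- A point of the boundary of a thickening sees, at every scale, a comparable ball inside the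
thickening, so it is not a density point of the boundary. -/
theorem measure_cthickening_diff_thickening {r : ℝ} (hr : 0 < r) (s : Set E) :
    μ (cthickening r s \ thickening r s) = 0 := by
  let A : Set E := cthickening r s \ thickening r s
  have hA : MeasurableSet A :=
    isClosed_cthickening.measurableSet.diff isOpen_thickening.measurableSet
  have hdensity := IsUnifLocDoublingMeasure.ae_tendsto_measure_inter_div μ A 2
  rw [ae_restrict_iff' hA] at hdensity
  refine measure_eq_zero_iff_ae_notMem.2 ?_
  filter_upwards [hdensity] with x hx hxA
  obtain ⟨y, hys, hxy⟩ : ∃ y ∈ closure s, dist x y ≤ r := by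
    simpa [← cthickening_closure (s := s), isClosed_closure.cthickening_eq_biUnion_closedBall hr.le]
      using hxA.1
  let c (δ : ℝ) : E := AffineMap.lineMap x y (2 * δ / r)
  have hδ : ∀ᶠ δ in 𝓝[>] (0 : ℝ), 0 < δ ∧ δ < r / 2 := Ioo_mem_nhdsGT (half_pos hr)
  have hxc : ∀ᶠ δ in 𝓝[>] (0 : ℝ), x ∈ closedBall (c δ) (2 * δ) := by
    filter_upwards [hδ] with δ ⟨hδ₀, _⟩
    rw [mem_closedBall, dist_left_lineMap, Real.norm_of_nonneg (by positivity)]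
    exact (mul_le_mul_of_nonneg_left hxy (by positivity)).trans_eq (div_mul_cancel₀ _ hr.ne')
  have hdisj : ∀ᶠ δ in 𝓝[>] (0 : ℝ), A ∩ closedBall (c δ) δ = ∅ := by
    filter_upwards [hδ] with δ ⟨hδ₀, hδr⟩
    refine eq_empty_of_forall_notMem fun z hz => hz.1.2 ?_
    have hδr' : 0 ≤ 1 - 2 * δ / r := by
      rw [sub_nonneg, div_le_one hr]
      linarith
    have hcy : dist (c δ) y ≤ r - 2 * δ := by
      rw [dist_lineMap_right, Real.norm_of_nonneg hδr']
      refine (mul_le_mul_of_nonneg_left hxy hδr').trans_eq ?_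
      field_simp
    rw [← thickening_closure, mem_thickening_iff]
    refine ⟨y, hys, (dist_triangle z (c δ) y).trans_lt ?_⟩
    linarith [mem_closedBall.1 hz.2]
  have hlim := hx hxA c id tendsto_id hxc
  have hzero : (fun δ => μ (A ∩ closedBall (c δ) δ) / μ (closedBall (c δ) δ)) =ᶠ[𝓝[>] 0] 0 := by
    filter_upwards [hdisj] with δ hδ
    simp [hδ]
  exact zero_ne_one (tendsto_nhds_unique_of_eventuallyEq tendsto_const_nhds hlim hzero.symm)

end Thickening

section Interface

variable {N : ℕ} {r h : ℝ}

/-- The centres of the balls of radius `r` that meet both `G` and its complement in positive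
measure. -/
def interfaceSet (r : ℝ) (G : Set (Space N)) : Set (Space N) :=
  {w | volume (ball w r ∩ G) ≠ 0 ∧ volume (ball w r ∩ Gᶜ) ≠ 0}

theorem measure_ball_inter_ne_zero_iff {G : Set (Space N)} {w : Space N} :
    volume (ball w r ∩ G) ≠ 0 ↔ w ∈ thickening r (volume.restrict G).support := by
  rw [← Measure.restrict_apply measurableSet_ball, mem_thickening_iff]
  constructor
  · intro hw
    obtain ⟨x, hx, hx'⟩ := Measure.nonempty_inter_support_of_pos (pos_iff_ne_zero.2 hw)
    exact ⟨x, hx', by rwa [dist_comm]⟩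
  · rintro ⟨x, hx, hd⟩
    exact ((Measure.mem_support_iff_forall x).1 hx _
      (isOpen_ball.mem_nhds (by rwa [mem_ball, dist_comm]))).ne'

theorem interfaceSet_eq (r : ℝ) (G : Set (Space N)) :
    interfaceSet r G = thickening r (volume.restrict G).support ∩
      thickening r (volume.restrict Gᶜ).support :=
  ext fun _ => and_congr measure_ball_inter_ne_zero_iff measure_ball_inter_ne_zero_iff

theorem measurableSet_interfaceSet (r : ℝ) (G : Set (Space N)) :
    MeasurableSet (interfaceSet r G) := by
  rw [interfaceSet_eq]
  exact (isOpen_thickening.inter isOpen_thickening).measurableSet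

theorem interfaceSet_ae_eq_cthickening (hr : 0 < r) (G : Set (Space N)) :
    interfaceSet r G =ᵐ[volume] (cthickening r (volume.restrict G).support ∩
      cthickening r (volume.restrict Gᶜ).support : Set (Space N)) := by
  have hK (K : Set (Space N)) : thickening r K =ᵐ[volume] cthickening r K :=
    (thickening_subset_cthickening r K).eventuallyLE.antisymm
      (ae_le_set.2 (measure_cthickening_diff_thickening volume hr K))
  rw [interfaceSet_eq]
  exact (hK _).inter (hK _)

theorem essOsc_indicator_of_notMem_interfaceSet (hr : 0 < r) {G : Set (Space N)} {w : Space N}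
    (hw : w ∉ interfaceSet r G) : essOsc (ball w r) (G.indicator fun _ => (1 : ℝ)) = 0 := by
  have hne : volume.restrict (ball w r) ≠ 0 := by
    simpa [Measure.restrict_eq_zero] using (measure_ball_pos volume w hr).ne'
  obtain ⟨c, hc⟩ : ∃ c : ℝ, (fun x => ((G.indicator (fun _ => (1 : ℝ)) x : ℝ) : EReal))
      =ᵐ[volume.restrict (ball w r)] fun _ => (c : EReal) := by
    rcases not_and_or.1 hw with hG | hG <;> rw [not_not, measure_eq_zero_iff_ae_notMem] at hG
    · refine ⟨0, (ae_restrict_iff' measurableSet_ball).2 ?_⟩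
      filter_upwards [hG] with x hx hxw
      rw [indicator_of_notMem fun hxG => hx ⟨hxw, hxG⟩]
    · refine ⟨1, (ae_restrict_iff' measurableSet_ball).2 ?_⟩
      filter_upwards [hG] with x hx hxw
      rw [indicator_of_mem (not_not.1 fun hxG => hx ⟨hxw, hxG⟩)]
  rw [essOsc, essSup_congr_ae hc, essInf_congr_ae hc, essSup_const _ hne, essInf_const _ hne,
    ← EReal.coe_sub, sub_self, EReal.coe_zero]

theorem essOsc_indicator_of_mem_interfaceSet {G : Set (Space N)} {w : Space N}
    (hw : w ∈ interfaceSet r G) : essOsc (ball w r) (G.indicator fun _ => (1 : ℝ)) = 1 := by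
  let f (x : Space N) : EReal := (G.indicator (fun _ => (1 : ℝ)) x : ℝ)
  have hsup : essSup f (volume.restrict (ball w r)) = 1 := by
    refine le_antisymm (essSup_le_of_ae_le _ (Eventually.of_forall fun x => ?_)) ?_
    · exact EReal.coe_le_coe_iff.2 (indicator_le_self' (fun _ _ => zero_le_one) x)
    · refine not_lt.1 fun hlt => hw.1 (measure_eq_zero_iff_ae_notMem.2 ?_)
      filter_upwards [ae_imp_of_ae_restrict (ae_lt_of_essSup_lt hlt)] with x hx hxG
      simpa [f, hxG.2] using hx hxG.1
  have hinf : essInf f (volume.restrict (ball w r)) = 0 := by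
    refine le_antisymm ?_ (le_essInf_of_ae_le _ (Eventually.of_forall fun x => ?_))
    · refine not_lt.1 fun hlt => hw.2 (measure_eq_zero_iff_ae_notMem.2 ?_)
      filter_upwards [ae_imp_of_ae_restrict (ae_lt_of_lt_essInf hlt)] with x hx hxG
      simpa [f, indicator_of_notMem hxG.2] using hx hxG.1
    · exact EReal.coe_le_coe_iff.2 (indicator_nonneg (fun _ _ => zero_le_one) x)
  rw [essOsc, hsup, hinf, sub_zero]

theorem nonlocalPer_eq (hr : 0 < r) (G : Set (Space N)) :
    nonlocalPer r G = ENNReal.ofReal (1 / (2 * r)) * volume (interfaceSet r G) := by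
  have hosc (w : Space N) : (essOsc (ball w r) (G.indicator fun _ => (1 : ℝ))).toENNReal =
      (interfaceSet r G).indicator 1 w := by
    by_cases hw : w ∈ interfaceSet r G
    · rw [essOsc_indicator_of_mem_interfaceSet hw, indicator_of_mem hw]
      exact EReal.toENNReal_coe (x := 1)
    · rw [essOsc_indicator_of_notMem_interfaceSet hr hw, indicator_of_notMem hw,
        EReal.toENNReal_zero]
  simp only [nonlocalPer, nonlocalTV, hosc,
    lintegral_indicator_one (measurableSet_interfaceSet r G)]

theorem exists_ae_eq_subset_support {G : Set (Space N)} (hG : NullMeasurableSet G) :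
    ∃ G' : Set (Space N), MeasurableSet G' ∧ G' =ᵐ[volume] G ∧
      G' ⊆ (volume.restrict G).support ∧ G'ᶜ ⊆ (volume.restrict Gᶜ).support := by
  obtain ⟨G₀, -, hG₀, hae⟩ := hG.exists_measurable_superset_ae_eq
  set K₁ := (volume.restrict G).support
  set K₂ := (volume.restrict Gᶜ).support
  have hK : K₁ ∪ K₂ = univ := by
    rw [← Measure.support_add, ← Measure.restrict_union₀ disjoint_compl_right.aedisjoint hG.compl,
      union_compl_self, Measure.restrict_univ, Measure.support_eq_univ]
  have hK₁ : ∀ᵐ x, x ∈ G → x ∈ K₁ := (ae_restrict_iff'₀ hG).1 Measure.support_mem_ae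
  have hK₂ : ∀ᵐ x, x ∈ Gᶜ → x ∈ K₂ := (ae_restrict_iff'₀ hG.compl).1 Measure.support_mem_ae
  refine ⟨G₀ ∩ K₁ ∪ K₂ᶜ, (hG₀.inter Measure.isClosed_support.measurableSet).union
    Measure.isClosed_support.measurableSet.compl, ?_, ?_, ?_⟩
  · rw [eventuallyEq_set]
    filter_upwards [hK₁, hK₂, hae.mem_iff] with x hx₁ hx₂ hx
    simp only [mem_union, mem_inter_iff, mem_compl_iff, hx] at hx₂ ⊢
    tauto
  · exact union_subset inter_subset_right (compl_subset_iff_union.2 (union_comm K₁ K₂ ▸ hK))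
  · rw [compl_union, compl_compl]
    exact inter_subset_right

theorem isBounded_of_ball_subset (hr : 0 < r) {K S : Set (Space N)}
    (hKS : ∀ x ∈ K, ball x r ⊆ S) (hfin : volume S ≠ ∞) : Bornology.IsBounded K := by
  have : IsFiniteMeasure (volume.restrict S) := ⟨by simpa using hfin.lt_top⟩
  obtain ⟨C, hC, hCS⟩ := isTightMeasureSet_iff_exists_isCompact_measure_compl_le.1
    (isTightMeasureSet_singleton (μ := volume.restrict S)) (volume (ball (0 : Space N) r) / 2)
    (ENNReal.half_pos (measure_ball_pos _ _ hr).ne')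
  refine hC.isBounded.thickening (δ := r) |>.subset fun x hx => ?_
  by_contra hxC
  have hsub : ball x r ⊆ Cᶜ ∩ S := fun y hy =>
    ⟨fun hyC => hxC (mem_thickening_iff.2 ⟨y, hyC, mem_ball'.1 hy⟩), hKS x hx hy⟩
  refine (ENNReal.half_lt_self (measure_ball_pos _ _ hr).ne' measure_ball_lt_top.ne).not_ge
    (le_trans ?_ (hCS _ rfl))
  rw [Measure.restrict_apply hC.measurableSet.compl, ← Measure.addHaar_ball_center volume x r]
  exact measure_mono hsub

theorem isBounded_of_subset_support (hr : 0 < r) {G G' : Set (Space N)} (hae : G' =ᵐ[volume] G)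
    (h₁ : G' ⊆ (volume.restrict G).support) (h₂ : G'ᶜ ⊆ (volume.restrict Gᶜ).support)
    (hG : volume G ≠ ∞) (hW : volume (interfaceSet r G) ≠ ∞) : Bornology.IsBounded G' := by
  refine isBounded_of_ball_subset hr (S := interfaceSet r G ∪ G') (fun x hx w hw => ?_)
    (measure_union_ne_top hW (measure_congr hae ▸ hG))
  refine or_iff_not_imp_right.2 fun hwG => ?_
  rw [interfaceSet_eq]
  exact ⟨mem_thickening_iff.2 ⟨x, h₁ hx, hw⟩, self_subset_thickening hr _ (h₂ hwG)⟩

theorem norm_pairDiff_indicator_le {G K₁ K₂ : Set (Space N)} (h₁ : G ⊆ K₁) (h₂ : Gᶜ ⊆ K₂)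
    (w : Space N) (p : ballPair N r) :
    ‖pairDiff (G.indicator fun _ => 1) w p‖ ≤
      (cthickening r K₁ ∩ cthickening r K₂).indicator (fun _ => 1) w := by
  have hmem {K : Set (Space N)} {x : Space N} (hx : x ∈ K) (hxw : x ∈ closedBall w r) :
      w ∈ cthickening r K := mem_cthickening_of_dist_le w x r K hx (mem_closedBall'.1 hxw)
  have hfst := add_fst_mem_closedBall w p
  have hsnd := add_snd_mem_closedBall w p
  by_cases hx : w + p.1.1 ∈ G <;> by_cases hy : w + p.1.2 ∈ G
  · simp [pairDiff, hx, hy, indicator_nonneg]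
  · rw [indicator_of_mem (mem_inter (hmem (h₁ hx) hfst) (hmem (h₂ hy) hsnd))]
    simp [pairDiff, hx, hy]
  · rw [indicator_of_mem (mem_inter (hmem (h₁ hy) hsnd) (hmem (h₂ hx) hfst))]
    simp [pairDiff, hx, hy]
  · simp [pairDiff, hx, hy, indicator_nonneg]

variable {g u : Space N → ℝ} {κ : Kernel (Space N) (ballPair N r)}

theorem norm_integral_pairDiff_indicator_le (hκ : ∀ w, κ w univ ≤ 1) (hr : 0 < r)
    {G G' : Set (Space N)} (h₁ : G' ⊆ (volume.restrict G).support)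
    (h₂ : G'ᶜ ⊆ (volume.restrict Gᶜ).support) (hW : volume (interfaceSet r G) ≠ ∞) :
    ‖∫ w, ∫ p, pairDiff (G'.indicator fun _ => 1) w p ∂κ w‖ ≤ volume.real (interfaceSet r G) := by
  let W' : Set (Space N) :=
    cthickening r (volume.restrict G).support ∩ cthickening r (volume.restrict Gᶜ).support
  have hW' : MeasurableSet W' := (isClosed_cthickening.inter isClosed_cthickening).measurableSet
  have hWW' : interfaceSet r G =ᵐ[volume] W' := interfaceSet_ae_eq_cthickening hr G
  rw [measureReal_congr hWW', ← integral_indicator_one hW']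
  refine norm_integral_le_of_norm_le ?_ (Eventually.of_forall fun w => ?_)
  · exact (integrable_indicator_iff hW').2 (integrableOn_const (measure_congr hWW' ▸ hW))
  · have : IsFiniteMeasure (κ w) := ⟨(hκ w).trans_lt ENNReal.one_lt_top⟩
    refine (norm_integral_le_of_norm_le_const (Eventually.of_forall
      (norm_pairDiff_indicator_le h₁ h₂ w))).trans (mul_le_of_le_one_right ?_ ?_)
    · exact indicator_nonneg (fun _ _ => zero_le_one) w
    · exact ENNReal.toReal_mono ENNReal.one_ne_top (hκ w)

theorem IsCalibratingKernel.setIntegral_eq (hκ : IsCalibratingKernel r h g u κ)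
    (hr : 0 < r) (hh : 0 < h) (hg : Continuous g) (hu : Continuous u) {G : Set (Space N)}
    (hG : MeasurableSet G) (hb : Bornology.IsBounded G) :
    ∫ x in G, (u x - g x) =
      -(h / (2 * r) * ∫ w, ∫ p, pairDiff (G.indicator fun _ => 1) w p ∂κ w) := by
  rw [hκ.equation_of_isTestFunction hr hh hg hu (isTestFunction_indicator hG hb 1),
    ← integral_indicator hG, ← integral_neg]
  congr 1 with x
  by_cases hx : x ∈ G <;> simp [hx]

theorem IsCalibratingKernel.setIntegral_le (hκ : IsCalibratingKernel r h g u κ) (hr : 0 < r)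
    (hh : 0 < h) (hg : Continuous g) (hu : Continuous u) {G : Set (Space N)}
    (hG : NullMeasurableSet G) (hfin : volume G ≠ ∞) (hW : volume (interfaceSet r G) ≠ ∞) :
    ∫ x in G, (u x - g x) ≤ h / (2 * r) * volume.real (interfaceSet r G) := by
  obtain ⟨G', hG', hae, h₁, h₂⟩ := exists_ae_eq_subset_support hG
  have hb := isBounded_of_subset_support hr hae h₁ h₂ hfin hW
  have hle := norm_integral_pairDiff_indicator_le hκ.mass_le_one hr h₁ h₂ hW
  rw [← setIntegral_congr_set hae, hκ.setIntegral_eq hr hh hg hu hG' hb, ← mul_neg]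
  exact mul_le_mul_of_nonneg_left ((neg_le_abs _).trans hle) (by positivity)

theorem measure_interfaceSet_lt_top {G : Set (Space N)} (hG : Bornology.IsBounded G) :
    volume (interfaceSet r G) < ∞ := by
  refine (measure_mono fun w hw => ?_).trans_lt (hG.thickening (δ := r)).measure_lt_top
  obtain ⟨x, hxw, hxG⟩ := nonempty_of_measure_ne_zero hw.1
  exact mem_thickening_iff.2 ⟨x, hxG, mem_ball'.1 hxw⟩

theorem indicator_interfaceSet_le (hr : 0 < r) (hu : Continuous u) {I : Set ℝ} (hI : IsLowerSet I)
    (w : Space N) : (interfaceSet r (u ⁻¹' I)).indicator 1 w ≤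
      I.indicator (fun _ => (1 : ℝ)) (ballInf r u w) -
        I.indicator (fun _ => (1 : ℝ)) (ballSup r u w) := by
  by_cases hw : w ∈ interfaceSet r (u ⁻¹' I)
  · obtain ⟨x, hxw, hx⟩ := nonempty_of_measure_ne_zero hw.1
    obtain ⟨y, hyw, hy⟩ := nonempty_of_measure_ne_zero hw.2
    have hinf : ballInf r u w ∈ I := hI (ballInf_le hu (ball_subset_closedBall hxw)) hx
    have hsup : ballSup r u w ∉ I := fun h => hy (hI (le_ballSup hu (ball_subset_closedBall hyw)) h)
    simp [hw, hinf, hsup]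
  · rw [indicator_of_notMem hw, sub_nonneg]
    by_cases hsup : ballSup r u w ∈ I
    · simp [hsup, hI (ballInf_le_ballSup hr.le hu w) hsup]
    · simpa [hsup] using indicator_nonneg (fun _ _ => zero_le_one) _

/-- The Cahn–Hoffman field of `u` moves mass from the minima to the maxima of `u`, hence across
every interface of a sublevel set with full strength. -/
theorem IsCalibratingKernel.setIntegral_preimage_eq (hκ : IsCalibratingKernel r h g u κ)
    (hr : 0 < r) (hh : 0 < h) (hg : Continuous g) (hu : Continuous u) {I : Set ℝ}
    (hI : IsLowerSet I) (hm : MeasurableSet I) (hb : Bornology.IsBounded (u ⁻¹' I)) :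
    ∫ x in u ⁻¹' I, (u x - g x) = h / (2 * r) * volume.real (interfaceSet r (u ⁻¹' I)) := by
  have hS : MeasurableSet (u ⁻¹' I) := hu.measurable hm
  refine le_antisymm (hκ.setIntegral_le hr hh hg hu hS.nullMeasurableSet hb.measure_lt_top.ne
    (measure_interfaceSet_lt_top hb).ne) ?_
  have := hκ.isFiniteKernel
  have hint := integrable_integral_pairDiff (κ := κ) (isTestFunction_indicator hS hb 1)
  rw [hκ.setIntegral_eq hr hh hg hu hS hb, ← mul_neg, ← integral_neg,
    ← integral_indicator_one (measurableSet_interfaceSet r _)]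
  refine mul_le_mul_of_nonneg_left (integral_mono_ae ?_ hint.neg ?_) (by positivity)
  · exact (integrable_indicator_iff (measurableSet_interfaceSet r _)).2
      (integrableOn_const (measure_interfaceSet_lt_top hb).ne)
  · filter_upwards [hκ.integral_pairDiff] with w hw
    have hcomp := integral_pairDiff_comp hr.le (hκ.mass_le_one w) hu hw (I.indicator fun _ => 1)
    exact (indicator_interfaceSet_le hr hu hI w).trans_eq (by rw [← neg_sub, ← hcomp]; rfl)

end Interface

section SetIntegralMin

variable {X : Type*} [MeasurableSpace X] {μ : Measure X} {f : X → ℝ} {G : Set X}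

omit [MeasurableSpace X] in
theorem min_zero_le_indicator (G : Set X) (f : X → ℝ) (x : X) :
    min (f x) 0 ≤ G.indicator f x := by
  by_cases hx : x ∈ G <;> simp [hx]

theorem integral_min_zero_le_setIntegral (hf : Integrable (fun x => min (f x) 0) μ)
    (hG : NullMeasurableSet G μ) (hfG : IntegrableOn f G μ) :
    ∫ x, min (f x) 0 ∂μ ≤ ∫ x in G, f x ∂μ := by
  rw [← integral_indicator₀ hG]
  exact integral_mono hf (hfG.integrable_indicator₀ hG) (min_zero_le_indicator G f)

theorem setIntegral_eq_integral_min_zero_iff (hf : Integrable (fun x => min (f x) 0) μ)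
    (hG : NullMeasurableSet G μ) (hfG : IntegrableOn f G μ) :
    ∫ x in G, f x ∂μ = ∫ x, min (f x) 0 ∂μ ↔ {x | f x < 0} ≤ᵐ[μ] G ∧ G ≤ᵐ[μ] {x | f x ≤ 0} := by
  rw [← integral_indicator₀ hG, eq_comm, integral_eq_iff_of_ae_le hf
    (hfG.integrable_indicator₀ hG) (Eventually.of_forall (min_zero_le_indicator G f))]
  refine (eventually_congr (Eventually.of_forall fun x => ?_)).trans eventually_and
  change min (f x) 0 = G.indicator f x ↔ (f x < 0 → x ∈ G) ∧ (x ∈ G → f x ≤ 0)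
  by_cases hx : x ∈ G <;> simp [hx]

end SetIntegralMin

section Energy

variable {N : ℕ} {r h : ℝ} {f g u : Space N → ℝ} {F G : Set (Space N)}

theorem extIntegral_eq (hf : IntegrableOn f F volume) :
    extIntegral F f = ((∫ x in F, f x : ℝ) : EReal) := by
  have hn : ∫⁻ x in F, ENNReal.ofReal (-f x) ≠ ∞ := hf.neg.lintegral_lt_top.ne
  rw [integral_eq_lintegral_pos_part_sub_lintegral_neg_part hf, EReal.coe_sub, extIntegral,
    ← EReal.coe_ennreal_toReal hf.lintegral_lt_top.ne, ← EReal.coe_ennreal_toReal hn]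

theorem geomEnergy_eq (hr : 0 < r) (hf : IntegrableOn f F volume)
    (hF : volume (interfaceSet r F) ≠ ∞) :
    geomEnergy r h f F =
      ((1 / (2 * r) * volume.real (interfaceSet r F) + 1 / h * ∫ x in F, f x : ℝ) : EReal) := by
  have hper : (nonlocalPer r F : EReal) =
      ((1 / (2 * r) * volume.real (interfaceSet r F) : ℝ) : EReal) := by
    rw [nonlocalPer_eq hr, ← EReal.coe_ennreal_toReal (ENNReal.mul_ne_top ENNReal.ofReal_ne_top hF),
      ENNReal.toReal_mul, ENNReal.toReal_ofReal (by positivity), measureReal_def]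
  rw [geomEnergy, extIntegral_eq hf, hper, EReal.coe_add, EReal.coe_mul (1 / h)]

theorem nonlocalPer_ne_top_and_lintegral_ne_top (hh : 0 < h)
    (hneg : ∫⁻ x in F, ENNReal.ofReal (-f x) ≠ ∞) (hF : geomEnergy r h f F ≠ ⊤) :
    nonlocalPer r F ≠ ∞ ∧ ∫⁻ x in F, ENNReal.ofReal (f x) ≠ ∞ := by
  have hpos : ∫⁻ x in F, ENNReal.ofReal (f x) ≠ ∞ := by
    refine fun htop => hF ?_
    rw [geomEnergy, extIntegral, htop, EReal.coe_ennreal_top, EReal.top_sub (by simpa using hneg),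
      EReal.coe_mul_top_of_pos (by positivity)]
    exact EReal.add_top_of_ne_bot (EReal.coe_ennreal_ne_bot _)
  refine ⟨fun htop => hF ?_, hpos⟩
  rw [geomEnergy, htop, extIntegral, ← EReal.coe_ennreal_toReal hpos,
    ← EReal.coe_ennreal_toReal hneg, ← EReal.coe_sub, ← EReal.coe_mul]
  exact EReal.top_add_of_ne_bot (EReal.coe_ne_bot _)

theorem isBounded_setOf_le (hf : Tendsto f (cocompact (Space N)) atTop) (t : ℝ) :
    Bornology.IsBounded {x | f x ≤ t} := by
  rw [Bornology.isBounded_def, cobounded_eq_cocompact]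
  exact (hf.eventually_gt_atTop t).mono fun x hx => not_le.2 hx

theorem integrable_min_zero (hf : Continuous f) (hf' : Tendsto f (cocompact (Space N)) atTop) :
    Integrable fun x => min (f x) 0 := by
  refine Continuous.integrable_of_hasCompactSupport (by fun_prop)
    (HasCompactSupport.of_support_subset_isCompact (isBounded_setOf_le hf' 0).isCompact_closure
      fun x hx => subset_closure ?_)
  by_contra hx'
  exact hx (min_eq_right (not_le.1 hx').le)

theorem volume_ne_top_of_setLIntegral_ne_top (hf : Continuous f)
    (hf' : Tendsto f (cocompact (Space N)) atTop)
    (hF : ∫⁻ x in F, ENNReal.ofReal (f x) ≠ ∞) : volume F ≠ ∞ := by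
  have hbdd : volume.restrict F {x | f x ≤ 1} ≠ ∞ :=
    ne_top_of_le_ne_top (isBounded_setOf_le hf' 1).measure_lt_top.ne (Measure.restrict_apply_le F _)
  have hge : volume.restrict F {x | 1 ≤ ENNReal.ofReal (f x)} ≠ ∞ := by
    refine ne_top_of_le_ne_top hF ?_
    simpa using mul_meas_ge_le_lintegral (μ := volume.restrict F) hf.measurable.ennreal_ofReal 1
  rw [← Measure.restrict_apply_univ]
  refine measure_ne_top_of_subset (fun x _ => ?_) (measure_union_ne_top hbdd hge)
  simpa using le_total (f x) 1

theorem volume_ne_top_of_geomEnergy_ne_top (hr : 0 < r) (hh : 0 < h) (hf : Continuous f)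
    (hf' : Tendsto f (cocompact (Space N)) atTop) (hF : geomEnergy r h f F ≠ ⊤) :
    volume F ≠ ∞ ∧ volume (interfaceSet r F) ≠ ∞ := by
  have hneg : ∫⁻ x in F, ENNReal.ofReal (-f x) ≠ ∞ := by
    refine ne_top_of_le_ne_top (integrable_min_zero hf hf').neg.lintegral_lt_top.ne
      ((setLIntegral_le_lintegral _ _).trans (lintegral_mono fun x => ?_))
    exact ENNReal.ofReal_le_ofReal (neg_le_neg (min_le_left _ _))
  obtain ⟨hper, hpos⟩ := nonlocalPer_ne_top_and_lintegral_ne_top hh hneg hF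
  refine ⟨volume_ne_top_of_setLIntegral_ne_top hf hf' hpos, fun htop => hper ?_⟩
  rw [nonlocalPer_eq hr, htop, ENNReal.mul_top]
  simpa using hr

theorem integrableOn_of_volume_interfaceSet_ne_top (hr : 0 < r) (hG : NullMeasurableSet G)
    (hfin : volume G ≠ ∞) (hW : volume (interfaceSet r G) ≠ ∞) (hf : Continuous f) :
    IntegrableOn f G := by
  obtain ⟨G', -, hae, h₁, h₂⟩ := exists_ae_eq_subset_support hG
  have hb := isBounded_of_subset_support hr hae h₁ h₂ hfin hW
  exact ((hf.continuousOn.integrableOn_compact hb.isCompact_closure).mono_set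
    subset_closure).congr_set_ae hae.symm

theorem geomEnergy_sub_eq (hr : 0 < r) (hh : 0 < h) (hg : Continuous g) (hu : Continuous u) (t : ℝ)
    (hG : NullMeasurableSet G) (hfin : volume G ≠ ∞) (hW : volume (interfaceSet r G) ≠ ∞) :
    geomEnergy r h (fun x => g x - t) G = ((1 / h * (∫ x in G, (u x - t)) +
      1 / h * (h / (2 * r) * volume.real (interfaceSet r G) - ∫ x in G, (u x - g x)) : ℝ) :
        EReal) := by
  have hint {f : Space N → ℝ} (hf : Continuous f) : IntegrableOn f G :=
    integrableOn_of_volume_interfaceSet_ne_top hr hG hfin hW hf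
  have hsplit : ∫ x in G, (u x - t) = (∫ x in G, (u x - g x)) + ∫ x in G, (g x - t) := by
    rw [← integral_add (hint (by fun_prop)) (hint (by fun_prop))]
    simp only [sub_add_sub_cancel]
  rw [geomEnergy_eq hr (hint (by fun_prop)) hW, hsplit]
  congr 1
  field_simp
  ring

variable {κ : Kernel (Space N) (ballPair N r)}

theorem IsCalibratingKernel.le_geomEnergy (hκ : IsCalibratingKernel r h g u κ) (hr : 0 < r)
    (hh : 0 < h) (hg : Continuous g) (hu : Continuous u) (t : ℝ) (hG : NullMeasurableSet G)
    (hfin : volume G ≠ ∞) (hW : volume (interfaceSet r G) ≠ ∞) :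
    ((1 / h * ∫ x in G, (u x - t) : ℝ) : EReal) ≤ geomEnergy r h (fun x => g x - t) G := by
  rw [geomEnergy_sub_eq hr hh hg hu t hG hfin hW, EReal.coe_le_coe_iff]
  have := hκ.setIntegral_le hr hh hg hu hG hfin hW
  exact le_add_of_nonneg_right (mul_nonneg (by positivity) (sub_nonneg.2 this))

theorem IsCalibratingKernel.geomEnergy_preimage (hκ : IsCalibratingKernel r h g u κ) (hr : 0 < r)
    (hh : 0 < h) (hg : Continuous g) (hu : Continuous u) (t : ℝ) {I : Set ℝ} (hI : IsLowerSet I)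
    (hm : MeasurableSet I) (hb : Bornology.IsBounded (u ⁻¹' I)) :
    geomEnergy r h (fun x => g x - t) (u ⁻¹' I) =
      ((1 / h * ∫ x in u ⁻¹' I, (u x - t) : ℝ) : EReal) := by
  rw [geomEnergy_sub_eq hr hh hg hu t (hu.measurable hm).nullMeasurableSet hb.measure_lt_top.ne
    (measure_interfaceSet_lt_top hb).ne, hκ.setIntegral_preimage_eq hr hh hg hu hI hm hb, sub_self,
    mul_zero, add_zero]

theorem integrable_min_sub_zero (hu : u ∈ LipPlus N) (t : ℝ) :
    Integrable fun x => min (u x - t) 0 :=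
  integrable_min_zero ((continuous_of_mem_lipPlus hu).sub continuous_const)
    (tendsto_atTop_add_const_right _ (-t) hu.2)

theorem volume_ne_top_of_geomEnergy_sub_ne_top (hr : 0 < r) (hh : 0 < h) (hg : g ∈ LipPlus N)
    {t : ℝ} (hG : geomEnergy r h (fun x => g x - t) G ≠ ⊤) :
    volume G ≠ ∞ ∧ volume (interfaceSet r G) ≠ ∞ :=
  volume_ne_top_of_geomEnergy_ne_top hr hh ((continuous_of_mem_lipPlus hg).sub continuous_const)
    (tendsto_atTop_add_const_right _ (-t) hg.2) hG

theorem IsCalibratingKernel.integral_min_le_geomEnergy (hκ : IsCalibratingKernel r h g u κ)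
    (hr : 0 < r) (hh : 0 < h) (hg : g ∈ LipPlus N) (hu : u ∈ LipPlus N) (t : ℝ)
    (hG : NullMeasurableSet G) :
    ((1 / h * ∫ x, min (u x - t) 0 : ℝ) : EReal) ≤ geomEnergy r h (fun x => g x - t) G := by
  by_cases htop : geomEnergy r h (fun x => g x - t) G = ⊤
  · exact htop ▸ le_top
  have hgc := continuous_of_mem_lipPlus hg
  have huc := continuous_of_mem_lipPlus hu
  obtain ⟨hfin, hW⟩ := volume_ne_top_of_geomEnergy_sub_ne_top hr hh hg htop
  have hint : IntegrableOn (fun x => u x - t) G :=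
    integrableOn_of_volume_interfaceSet_ne_top hr hG hfin hW (huc.sub continuous_const)
  refine le_trans (EReal.coe_le_coe_iff.2 ?_) (hκ.le_geomEnergy hr hh hgc huc t hG hfin hW)
  have := integral_min_zero_le_setIntegral (integrable_min_sub_zero hu t) hG hint
  gcongr

theorem IsCalibratingKernel.ae_le_of_geomEnergy_le (hκ : IsCalibratingKernel r h g u κ)
    (hr : 0 < r) (hh : 0 < h) (hg : g ∈ LipPlus N) (hu : u ∈ LipPlus N) {t : ℝ}
    (hG : NullMeasurableSet G)
    (hle : geomEnergy r h (fun x => g x - t) G ≤ ((1 / h * ∫ x, min (u x - t) 0 : ℝ) : EReal)) :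
    {x | u x < t} ≤ᵐ[volume] G ∧ G ≤ᵐ[volume] {x | u x ≤ t} := by
  have hgc := continuous_of_mem_lipPlus hg
  have huc := continuous_of_mem_lipPlus hu
  obtain ⟨hfin, hW⟩ := volume_ne_top_of_geomEnergy_sub_ne_top hr hh hg
    (hle.trans_lt (EReal.coe_lt_top _)).ne
  have hint : IntegrableOn (fun x => u x - t) G :=
    integrableOn_of_volume_interfaceSet_ne_top hr hG hfin hW (huc.sub continuous_const)
  have hmin := integrable_min_sub_zero hu t
  have hGle : ∫ x in G, (u x - t) ≤ ∫ x, min (u x - t) 0 := by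
    refine le_of_mul_le_mul_left ?_ (one_div_pos.2 hh)
    exact EReal.coe_le_coe_iff.1 ((hκ.le_geomEnergy hr hh hgc huc t hG hfin hW).trans hle)
  have heq := hGle.antisymm (integral_min_zero_le_setIntegral hmin hG hint)
  simpa only [sub_neg, sub_nonpos] using (setIntegral_eq_integral_min_zero_iff hmin hG hint).1 heq

theorem IsCalibratingKernel.isGeomMinimizer_preimage (hκ : IsCalibratingKernel r h g u κ)
    (hr : 0 < r) (hh : 0 < h) (hg : g ∈ LipPlus N) (hu : u ∈ LipPlus N) {t : ℝ} {I : Set ℝ}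
    (hI : IsLowerSet I) (hm : MeasurableSet I) (htI : Iio t ⊆ I) (hIt : I ⊆ Iic t) :
    IsGeomMinimizer r h (fun x => g x - t) (u ⁻¹' I) ∧
      geomEnergy r h (fun x => g x - t) (u ⁻¹' I) =
        ((1 / h * ∫ x, min (u x - t) 0 : ℝ) : EReal) := by
  have huc := continuous_of_mem_lipPlus hu
  have hS : NullMeasurableSet (u ⁻¹' I) := (huc.measurable hm).nullMeasurableSet
  have hb : Bornology.IsBounded (u ⁻¹' I) := (isBounded_setOf_le hu.2 t).subset (preimage_mono hIt)
  have hint : IntegrableOn (fun x => u x - t) (u ⁻¹' I) :=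
    integrableOn_of_volume_interfaceSet_ne_top hr hS hb.measure_lt_top.ne
      (measure_interfaceSet_lt_top hb).ne (huc.sub continuous_const)
  have hmin : ∫ x in u ⁻¹' I, (u x - t) = ∫ x, min (u x - t) 0 := by
    refine (setIntegral_eq_integral_min_zero_iff (integrable_min_sub_zero hu t) hS hint).2
      ⟨Eventually.of_forall fun x hx => ?_, Eventually.of_forall fun x hx => ?_⟩
    · exact htI (sub_neg.1 hx)
    · exact sub_nonpos.2 (hIt hx)
  have heq := hκ.geomEnergy_preimage hr hh (continuous_of_mem_lipPlus hg) huc t hI hm hb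
  rw [hmin] at heq
  exact ⟨⟨hS, fun G hG => heq.trans_le (hκ.integral_min_le_geomEnergy hr hh hg hu t hG)⟩, heq⟩

theorem isMinimalMinimizer_and_isMaximalMinimizer (hr : 0 < r) (hh : 0 < h) (hg : g ∈ LipPlus N)
    (hu : u ∈ LipPlus N) (hs : IsSolution r h g u) (t : ℝ) :
    IsMinimalMinimizer r h (fun w => g w - t) {w | u w < t} ∧
      IsMaximalMinimizer r h (fun w => g w - t) {w | u w ≤ t} := by
  obtain ⟨κ, hκ⟩ := (isSolution_iff_exists_isCalibratingKernel hr (continuous_of_mem_lipPlus hg)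
    (continuous_of_mem_lipPlus hu)).1 hs
  obtain ⟨hmin, heq⟩ := hκ.isGeomMinimizer_preimage hr hh hg hu (isLowerSet_Iio t)
    measurableSet_Iio subset_rfl Iio_subset_Iic_self
  obtain ⟨hmax, -⟩ := hκ.isGeomMinimizer_preimage hr hh hg hu (isLowerSet_Iic t)
    measurableSet_Iic Iio_subset_Iic_self subset_rfl
  have hbetween (G) (hG : IsGeomMinimizer r h (fun w => g w - t) G) :=
    hκ.ae_le_of_geomEnergy_le hr hh hg hu hG.1 ((hG.2 _ hmin.1).trans_eq heq)
  exact ⟨⟨hmin, fun G hG => (hbetween G hG).1⟩, ⟨hmax, fun G hG => (hbetween G hG).2⟩⟩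

theorem isMinimalMinimizer_and_isMaximalMinimizer_of_lipMinus (hr : 0 < r) (hh : 0 < h)
    (hg : g ∈ LipMinus N) (hu : u ∈ LipMinus N) (hs : IsSolution r h g u) (t : ℝ) :
    IsMinimalMinimizer r h (fun w => t - g w) {w | t < u w} ∧
      IsMaximalMinimizer r h (fun w => t - g w) {w | t ≤ u w} := by
  have hneg := hs.neg hr (continuous_of_mem_lipMinus hg) (continuous_of_mem_lipMinus hu)
  simpa only [neg_lt_neg_iff, neg_le_neg_iff, sub_neg_eq_add, neg_add_eq_sub] using
    isMinimalMinimizer_and_isMaximalMinimizer hr hh (neg_mem_lipPlus hg) (neg_mem_lipPlus hu)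
      hneg (-t)

end Energy

section MonotoneEquation

theorem exists_fixedPoint_of_forall_le_add {X : Type*} {S : Set (X → ℝ)} (hS : IsClosed S)
    {T : (X → ℝ) → X → ℝ} (hT : MapsTo T S S) {θ : ℝ} (hθ : 0 < θ) (hθ' : θ < 1)
    (hle : ∀ u ∈ S, ∀ v ∈ S, ∀ c, (∀ x, u x ≤ v x + c) → ∀ x, T u x ≤ T v x + θ * c)
    {u₀ : X → ℝ} (hu₀ : u₀ ∈ S) {M : ℝ} (hM : ∀ x, |T u₀ x - u₀ x| ≤ M) :
    ∃ u ∈ S, T u = u := by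
  let S' : Set (UniformFun X ℝ) := UniformFun.toFun ⁻¹' S
  let T' (u : UniformFun X ℝ) : UniformFun X ℝ := UniformFun.ofFun (T (UniformFun.toFun u))
  have hS' : IsComplete S' :=
    (hS.preimage UniformFun.uniformContinuous_toFun.continuous).isComplete
  have hT' : MapsTo T' S' S' := fun u hu => hT hu
  have hcontr : ContractingWith θ.toNNReal (hT'.restrict T' S' S') := by
    refine ⟨Real.toNNReal_lt_one.2 hθ', fun u v => UniformFun.edist_le.2 fun x => ?_⟩
    by_cases htop : edist u v = ∞
    · rw [htop, ENNReal.mul_top (by simpa using hθ)]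
      exact le_top
    have hdist (x : X) :
        |UniformFun.toFun u.1 x - UniformFun.toFun v.1 x| ≤ (edist u v).toReal := by
      rw [← Real.dist_eq, dist_edist]
      exact ENNReal.toReal_mono htop (UniformFun.edist_eval_le (f := u.1) (g := v.1))
    rw [edist_dist, Real.dist_eq, ← ENNReal.ofReal_toReal htop, ENNReal.ofNNReal_toNNReal,
      ← ENNReal.ofReal_mul hθ.le]
    refine ENNReal.ofReal_le_ofReal (abs_sub_le_iff.2 ⟨?_, ?_⟩)
    · exact sub_le_iff_le_add'.2 (hle _ u.2 _ v.2 _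
        (fun y => sub_le_iff_le_add'.1 (abs_sub_le_iff.1 (hdist y)).1) x)
    · exact sub_le_iff_le_add'.2 (hle _ v.2 _ u.2 _
        (fun y => sub_le_iff_le_add'.1 (abs_sub_le_iff.1 (hdist y)).2) x)
  have hdist : edist (UniformFun.ofFun u₀) (T' (UniformFun.ofFun u₀)) ≠ ∞ := by
    refine ne_top_of_le_ne_top (ENNReal.ofReal_ne_top (r := M)) (UniformFun.edist_le.2 fun x => ?_)
    rw [edist_comm, edist_dist]
    exact ENNReal.ofReal_le_ofReal (hM x)
  obtain ⟨u, hu, hfix, -⟩ := hcontr.exists_fixedPoint' hS' hT' hu₀ hdist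
  exact ⟨UniformFun.toFun u, hu, congrArg UniformFun.toFun hfix⟩

variable {E : Type*} [SeminormedAddCommGroup E]

theorem mul_sub_mul_le_of_le_add {A : (E → ℝ) → E → ℝ} {L : ℝ≥0} {C s : ℝ} (hs : 0 ≤ s)
    (hsC : s * C = 1 - s) (hconst : ∀ u c, A (fun x => u x + c) = A u)
    (hle : ∀ u v, LipschitzWith L u → LipschitzWith L v → (∀ x, u x ≤ v x) → ∀ x,
      A v x - A u x ≤ C * (v x - u x)) {u v : E → ℝ} (hu : LipschitzWith L u)
    (hv : LipschitzWith L v) {c : ℝ} (huv : ∀ x, u x ≤ v x + c) (x : E) :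
    (1 - s) * u x - s * A u x ≤ (1 - s) * v x - s * A v x + (1 - s) * c := by
  have hvc : LipschitzWith L fun x => v x + c := by
    simpa only [add_zero] using hv.add (LipschitzWith.const c)
  have := mul_le_mul_of_nonneg_left (hle u _ hu hvc huv x) hs
  rw [hconst, ← mul_assoc, hsC] at this
  linarith

theorem exists_lipschitzWith_add_eq {A : (E → ℝ) → E → ℝ} {L : ℝ≥0} {C M : ℝ} (hC : 0 < C)
    (hconst : ∀ u c, A (fun x => u x + c) = A u)
    (htrans : ∀ u a x, A (fun y => u (y + a)) x = A u (x + a))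
    (hbdd : ∀ u, LipschitzWith L u → ∀ x, |A u x| ≤ M)
    (hle : ∀ u v, LipschitzWith L u → LipschitzWith L v → (∀ x, u x ≤ v x) → ∀ x,
      A v x - A u x ≤ C * (v x - u x)) {g : E → ℝ} (hg : LipschitzWith L g) :
    ∃ u, LipschitzWith L u ∧ ∀ x, u x + A u x = g x := by
  let s : ℝ := (1 + C)⁻¹
  have hs : 0 < s := by positivity
  have hsC : s * C = 1 - s := by
    simp only [s]
    field_simp
    ring
  let T (u : E → ℝ) (x : E) : ℝ := (1 - s) * u x + s * (g x - A u x)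
  have hTS : MapsTo T {u | LipschitzWith L u} {u | LipschitzWith L u} := by
    intro u hu
    refine LipschitzWith.of_le_add_mul L fun x y => ?_
    have hshift : LipschitzWith L fun z => u (z + (x - y)) := by
      simpa [Function.comp_def] using hu.comp (LipschitzWith.id.add (LipschitzWith.const (x - y)))
    have hu' (z : E) : u (z + (x - y)) ≤ u z + L * dist x y := by
      simpa [dist_eq_norm] using hu.le_add_mul (z + (x - y)) z
    have := mul_sub_mul_le_of_le_add hs.le hsC hconst hle hshift hu hu' y
    rw [htrans, add_sub_cancel] at this
    have := mul_le_mul_of_nonneg_left (hg.le_add_mul x y) hs.le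
    simp only [T]
    linarith
  have hTg (x : E) : |T g x - g x| ≤ s * M := by
    have hx : T g x - g x = -(s * A g x) := by
      simp only [T]
      ring
    rw [hx, abs_neg, abs_mul, abs_of_pos hs]
    exact mul_le_mul_of_nonneg_left (hbdd g hg x) hs.le
  obtain ⟨u, hu, hfix⟩ := exists_fixedPoint_of_forall_le_add (isClosed_setOfPred_lipschitzWith L)
    hTS (θ := 1 - s) (hsC ▸ by positivity) (sub_lt_self 1 hs)
    (fun u hu v hv c huv x => by
      simp only [T]
      linarith [mul_sub_mul_le_of_le_add hs.le hsC hconst hle hu hv huv x]) hg hTg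
  refine ⟨u, hu, fun x => ?_⟩
  have hx : (1 - s) * u x + s * (g x - A u x) = u x := congrFun hfix x
  have : s * (u x + A u x - g x) = 0 := by linarith
  linarith [(mul_eq_zero.1 this).resolve_left hs.ne']

end MonotoneEquation

section Gibbs

variable {N : ℕ} {r : ℝ} {ν : Measure (closedBall (0 : Space N) r)} {u v : Space N → ℝ} {L : ℝ≥0}

/-- The partition function of the Gibbs measure with density proportional to `p ↦ exp (u (w + p))`
with respect to `ν`. -/
def partitionFunction (ν : Measure (closedBall (0 : Space N) r)) (u : Space N → ℝ) (w : Space N) :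
    ℝ :=
  ∫ p, Real.exp (u (w + p)) ∂ν

/-- The density at `x` of the Lebesgue average over `w` of the Gibbs measures centered at `w`. It is
the derivative at `u` of the convex functional `u ↦ ∫ log (partitionFunction ν u w) dw`. -/
def softMax (ν : Measure (closedBall (0 : Space N) r)) (u : Space N → ℝ) (x : Space N) : ℝ :=
  ∫ p, Real.exp (u x) / partitionFunction ν u (x - p) ∂ν

theorem continuous_integral_right [IsFiniteMeasure ν] {F : Space N → closedBall (0 : Space N) r → ℝ}
    (hF : Continuous F.uncurry) : Continuous fun w => ∫ p, F w p ∂ν := by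
  simpa only [Measure.restrict_univ] using
    continuous_parametric_integral_of_continuous (μ := ν) hF isCompact_univ

theorem integrable_of_continuous [IsFiniteMeasure ν] {f : closedBall (0 : Space N) r → ℝ}
    (hf : Continuous f) : Integrable f ν :=
  hf.integrable_of_hasCompactSupport (HasCompactSupport.of_compactSpace f)

theorem integrable_exp_comp_add [IsFiniteMeasure ν] (hu : Continuous u) (w : Space N) :
    Integrable (fun p : closedBall (0 : Space N) r => Real.exp (u (w + p))) ν :=
  integrable_of_continuous (by fun_prop)

theorem continuous_partitionFunction [IsFiniteMeasure ν] (hu : Continuous u) :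
    Continuous (partitionFunction ν u) :=
  continuous_integral_right (by fun_prop)

theorem partitionFunction_pos [IsFiniteMeasure ν] [NeZero ν] (hu : Continuous u) (w : Space N) :
    0 < partitionFunction ν u w :=
  integral_exp_pos (integrable_exp_comp_add hu w)

theorem continuous_softMax_integrand [IsFiniteMeasure ν] [NeZero ν] (hu : Continuous u) :
    Continuous fun q : Space N × closedBall (0 : Space N) r =>
      Real.exp (u q.1) / partitionFunction ν u (q.1 - q.2) := by
  have := continuous_partitionFunction (ν := ν) hu
  exact Continuous.div (by fun_prop) (by fun_prop) fun q => (partitionFunction_pos hu _).ne'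

theorem continuous_softMax_integrand_right [IsFiniteMeasure ν] [NeZero ν] (hu : Continuous u)
    (x : Space N) : Continuous fun p : closedBall (0 : Space N) r =>
      Real.exp (u x) / partitionFunction ν u (x - p) :=
  (continuous_softMax_integrand hu).comp (by fun_prop : Continuous fun p => (x, p))

theorem continuous_softMax [IsFiniteMeasure ν] [NeZero ν] (hu : Continuous u) :
    Continuous (softMax ν u) :=
  continuous_integral_right (continuous_softMax_integrand hu)

theorem softMax_add_const (u : Space N → ℝ) (c : ℝ) :
    softMax ν (fun x => u x + c) = softMax ν u := by
  ext x
  simp only [softMax, partitionFunction, Real.exp_add, integral_mul_const,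
    mul_div_mul_right _ _ (Real.exp_ne_zero c)]

theorem softMax_comp_add (u : Space N → ℝ) (a x : Space N) :
    softMax ν (fun y => u (y + a)) x = softMax ν u (x + a) := by
  have hswap (p q : Space N) : x - p + q + a = x + a - p + q := by abel
  simp only [softMax, partitionFunction, hswap]

theorem softMax_nonneg (x : Space N) : 0 ≤ softMax ν u x :=
  integral_nonneg fun _ => div_nonneg (Real.exp_pos _).le
    (integral_nonneg fun _ => (Real.exp_pos _).le)

theorem exp_mul_measureReal_univ_le_partitionFunction [IsFiniteMeasure ν]
    (hu : LipschitzWith L u) (x : Space N) (p : closedBall (0 : Space N) r) :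
    Real.exp (u x - L * (2 * r)) * ν.real univ ≤ partitionFunction ν u (x - p) := by
  have hu' := hu.continuous
  rw [mul_comm, ← smul_eq_mul, ← integral_const]
  refine integral_mono (integrable_const _) (integrable_exp_comp_add hu' _) fun q => ?_
  refine Real.exp_le_exp.2 ?_
  have hdist : dist x (x - p + q) ≤ 2 * r := by
    have hp := mem_closedBall_zero_iff.1 p.2
    have hq := mem_closedBall_zero_iff.1 q.2
    rw [dist_eq_norm, show x - (x - p + q) = (p : Space N) - q by abel]
    linarith [norm_sub_le (p : Space N) q]
  have hmul : (L : ℝ) * dist x (x - p + q) ≤ L * (2 * r) :=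
    mul_le_mul_of_nonneg_left hdist L.2
  linarith [hu.le_add_mul x (x - p + q)]

theorem softMax_le [IsFiniteMeasure ν] [NeZero ν] (hu : LipschitzWith L u) (x : Space N) :
    softMax ν u x ≤ Real.exp (L * (2 * r)) := by
  have hν : 0 < ν.real univ := measureReal_univ_pos
  calc softMax ν u x ≤ ∫ _, Real.exp (L * (2 * r)) / ν.real univ ∂ν := ?_
    _ = Real.exp (L * (2 * r)) := by
      rw [integral_const, smul_eq_mul, mul_div_cancel₀ _ hν.ne']
  refine integral_mono (integrable_of_continuous ?_) (integrable_const _) fun p => ?_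
  · exact continuous_softMax_integrand_right hu.continuous x
  · rw [div_le_div_iff₀ (partitionFunction_pos hu.continuous _) hν]
    calc Real.exp (u x) * ν.real univ
        = Real.exp (L * (2 * r)) * (Real.exp (u x - L * (2 * r)) * ν.real univ) := by
          rw [← mul_assoc, ← Real.exp_add, add_sub_cancel]
      _ ≤ Real.exp (L * (2 * r)) * partitionFunction ν u (x - p) := by
          gcongr
          exact exp_mul_measureReal_univ_le_partitionFunction hu x p

theorem softMax_sub_le [IsFiniteMeasure ν] [NeZero ν] (hu : Continuous u)
    (hv : LipschitzWith L v) (huv : ∀ y, u y ≤ v y) (x : Space N) :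
    softMax ν v x - softMax ν u x ≤ Real.exp (L * (2 * r)) * (v x - u x) := by
  have hexp : Real.exp (u x - v x) * softMax ν v x ≤ softMax ν u x := by
    rw [softMax, ← integral_const_mul]
    refine integral_mono
      ((integrable_of_continuous (continuous_softMax_integrand_right hv.continuous x)).const_mul _)
      (integrable_of_continuous (continuous_softMax_integrand_right hu x)) fun p => ?_
    simp only
    rw [← mul_div_assoc, ← Real.exp_add, sub_add_cancel]
    exact div_le_div_of_nonneg_left (Real.exp_pos _).le (partitionFunction_pos hu _)
      (integral_mono (integrable_exp_comp_add hu _)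
        (integrable_exp_comp_add hv.continuous _) fun q => Real.exp_le_exp.2 (huv _))
  calc softMax ν v x - softMax ν u x
      ≤ softMax ν v x - Real.exp (u x - v x) * softMax ν v x := by gcongr
    _ = (1 - Real.exp (u x - v x)) * softMax ν v x := by ring
    _ ≤ (v x - u x) * softMax ν v x := by
        refine mul_le_mul_of_nonneg_right ?_ (softMax_nonneg x)
        linarith [Real.add_one_le_exp (u x - v x)]
    _ ≤ (v x - u x) * Real.exp (L * (2 * r)) := by
        gcongr
        · exact sub_nonneg.2 (huv x)
        · exact softMax_le hv x
    _ = Real.exp (L * (2 * r)) * (v x - u x) := mul_comm _ _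

theorem exists_lipschitzWith_add_softMax_sub_softMax_eq [IsFiniteMeasure ν] [NeZero ν] {c β : ℝ}
    (hc : 0 < c) (hβ : 0 < β) {g : Space N → ℝ} (hg : LipschitzWith L g) :
    ∃ u, LipschitzWith L u ∧ ∀ x,
      u x + c * (softMax ν (fun y => β * u y) x - softMax ν (fun y => -(β * u y)) x) = g x := by
  have hmul {u : Space N → ℝ} (hu : LipschitzWith L u) :
      LipschitzWith (‖β‖₊ * L) fun y => β * u y := (lipschitzWith_smul β).comp hu
  have hmul' {u : Space N → ℝ} (hu : LipschitzWith L u) :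
      LipschitzWith (‖β‖₊ * L) fun y => -(β * u y) := (hmul hu).neg
  refine exists_lipschitzWith_add_eq (M := c * Real.exp ((‖β‖₊ * L : ℝ≥0) * (2 * r)))
    (C := c * (2 * (Real.exp ((‖β‖₊ * L : ℝ≥0) * (2 * r)) * β))) (by positivity) (fun u k => ?_)
    (fun u a x => ?_) (fun u hu x => ?_) (fun u v hu hv huv x => ?_) hg
  · simp only [mul_add, neg_add, softMax_add_const]
  · rw [← softMax_comp_add, ← softMax_comp_add]
  · rw [abs_mul, abs_of_pos hc]
    refine mul_le_mul_of_nonneg_left (abs_sub_le_iff.2 ⟨?_, ?_⟩) hc.le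
    · exact (sub_le_self _ (softMax_nonneg x)).trans (softMax_le (hmul hu) x)
    · exact (sub_le_self _ (softMax_nonneg x)).trans (softMax_le (hmul' hu) x)
  · have hpos := softMax_sub_le (ν := ν) (hmul hu).continuous (hmul hv)
      (fun y => mul_le_mul_of_nonneg_left (huv y) hβ.le) x
    have hneg := softMax_sub_le (ν := ν) (hmul' hv).continuous (hmul' hu)
      (fun y => neg_le_neg (mul_le_mul_of_nonneg_left (huv y) hβ.le)) x
    rw [← mul_sub, mul_assoc]
    refine mul_le_mul_of_nonneg_left ?_ hc.le
    linarith

end Gibbs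

section Concentration

theorem exp_mul_exp_neg (x : ℝ) : Real.exp x * Real.exp (-x) = 1 := by
  rw [← Real.exp_add, add_neg_cancel, Real.exp_zero]

theorem integrable_exp_neg_tilted {α : Type*} [MeasurableSpace α] {μ : Measure α}
    [IsFiniteMeasure μ] {f : α → ℝ} (hf : Integrable (fun a => Real.exp (f a)) μ) :
    Integrable (fun a => Real.exp (-f a)) (μ.tilted f) := by
  simp only [integrable_tilted_iff hf, smul_eq_mul, exp_mul_exp_neg]
  exact integrable_const _

theorem integral_exp_neg_tilted {α : Type*} [MeasurableSpace α] (μ : Measure α) (f : α → ℝ) :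
    ∫ a, Real.exp (-f a) ∂μ.tilted f = μ.real univ / ∫ a, Real.exp (f a) ∂μ := by
  simp only [integral_tilted, smul_eq_mul, div_mul_eq_mul_div, exp_mul_exp_neg, integral_const,
    mul_one_div]

theorem integral_sub_tilted_le {α : Type*} [MeasurableSpace α] {μ : Measure α} [IsFiniteMeasure μ]
    {f : α → ℝ} {β c m ε : ℝ} (hβ : 0 < β) (hf : Integrable (fun a => Real.exp (β * f a)) μ)
    (hm : ∀ a, f a ≤ m) (hc : 0 < c) (hcε : c ≤ μ.real {a | m - ε ≤ f a}) :
    ∫ a, (m - f a) ∂μ.tilted (fun a => β * f a) ≤ ε + μ.real univ / (c * β) := by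
  have : NeZero μ := ⟨by
    rintro rfl
    exact hc.not_ge (by simpa only [measureReal_zero_apply] using hcε)⟩
  have := isProbabilityMeasure_tilted hf
  let Z := ∫ a, Real.exp (β * f a) ∂μ
  have hZ : 0 < Z := integral_exp_pos hf
  have hZc : c * Real.exp (β * (m - ε)) ≤ Z := by
    have hmarkov := mul_meas_ge_le_integral_of_nonneg (ae_of_all _ fun a => (Real.exp_pos _).le) hf
      (Real.exp (β * (m - ε)))
    simp only [Real.exp_le_exp, mul_le_mul_iff_right₀ hβ] at hmarkov
    rw [mul_comm]
    exact (mul_le_mul_of_nonneg_left hcε (Real.exp_pos _).le).trans hmarkov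
  have hpoint (a : α) :
      m - f a ≤ ε + Real.exp (β * (m - ε)) * Real.exp (-(β * f a)) / β := by
    have hexp := Real.add_one_le_exp (β * (m - ε) + -(β * f a))
    rw [Real.exp_add] at hexp
    rw [← sub_le_iff_le_add', le_div_iff₀ hβ]
    linarith
  have hint := integrable_exp_neg_tilted hf
  have hval : ∫ a, Real.exp (-(β * f a)) ∂μ.tilted (fun a => β * f a) = μ.real univ / Z :=
    integral_exp_neg_tilted μ _
  calc ∫ a, (m - f a) ∂μ.tilted (fun a => β * f a)
      ≤ ∫ a, (ε + Real.exp (β * (m - ε)) * Real.exp (-(β * f a)) / β)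
          ∂μ.tilted (fun a => β * f a) :=
        integral_mono_of_nonneg (ae_of_all _ fun a => sub_nonneg.2 (hm a))
          ((integrable_const _).add ((hint.const_mul _).div_const _)) (ae_of_all _ hpoint)
    _ = ε + μ.real univ * Real.exp (β * (m - ε)) / (Z * β) := by
        rw [integral_add (integrable_const _) ((hint.const_mul _).div_const _), integral_div,
          integral_const_mul, hval, integral_const, probReal_univ, one_smul]
        field_simp
    _ ≤ ε + μ.real univ / (c * β) := by
        gcongr ε + ?_
        rw [div_le_div_iff₀ (by positivity) (by positivity)]
        calc μ.real univ * Real.exp (β * (m - ε)) * (c * β)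
            = μ.real univ * β * (c * Real.exp (β * (m - ε))) := by ring
          _ ≤ μ.real univ * β * Z := by gcongr
          _ = μ.real univ * (Z * β) := by ring

theorem exists_pos_forall_le_measureReal_ball {X : Type*} [PseudoMetricSpace X] [CompactSpace X]
    [MeasurableSpace X] (μ : Measure X) [IsFiniteMeasure μ] [μ.IsOpenPosMeasure] {δ : ℝ}
    (hδ : 0 < δ) : ∃ c > 0, ∀ x, c ≤ μ.real (ball x δ) := by
  obtain ⟨t, -, ht, hcover⟩ := finite_cover_balls_of_compact (isCompact_univ (X := X)) (half_pos hδ)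
  have hsmall : ∀ᶠ c in 𝓝[>] (0 : ℝ), ∀ y ∈ t, c < μ.real (ball y (δ / 2)) := by
    refine ht.eventually_all.2 fun y _ => mem_nhdsWithin_of_mem_nhds (Iio_mem_nhds ?_)
    exact ENNReal.toReal_pos (measure_ball_pos μ y (half_pos hδ)).ne' (measure_ne_top _ _)
  obtain ⟨c, hc, hc0⟩ := (hsmall.and self_mem_nhdsWithin).exists
  refine ⟨c, hc0, fun x => ?_⟩
  obtain ⟨y, hy, hxy⟩ := mem_iUnion₂.1 (hcover (mem_univ x))
  refine (hc y hy).le.trans (measureReal_mono (ball_subset_ball' ?_))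
  rw [dist_comm]
  linarith [mem_ball.1 hxy]

theorem isOpenPosMeasure_comap_closedBall {E : Type*} [NormedAddCommGroup E] [NormedSpace ℝ E]
    [MeasurableSpace E] [BorelSpace E] (μ : Measure E) [μ.IsOpenPosMeasure] (x : E) {r : ℝ}
    (hr : r ≠ 0) : (μ.comap ((↑) : closedBall x r → E)).IsOpenPosMeasure := by
  refine ⟨fun U hU ⟨p, hp⟩ => ?_⟩
  obtain ⟨V, hV, rfl⟩ := isOpen_induced_iff.1 hU
  have hp' : (p : E) ∈ closure (ball x r) := by
    rw [closure_ball x hr]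
    exact p.2
  have hne : (V ∩ ball x r).Nonempty := _root_.mem_closure_iff.1 hp' V hV hp
  rw [comap_subtype_coe_apply measurableSet_closedBall, Subtype.image_preimage_coe]
  exact ((hV.inter isOpen_ball).measure_pos μ hne).ne' ∘ fun h => measure_mono_null
    (inter_comm V (ball x r) ▸ inter_subset_inter_left _ ball_subset_closedBall) h

end Concentration

section GibbsKernel

theorem hasCompactSupport_comp_add {E K : Type*} [TopologicalSpace E] [AddGroup E]
    [IsTopologicalAddGroup E] [R1Space E] [TopologicalSpace K] [CompactSpace K] [R1Space K]
    {φ : E → ℝ} (hφ : HasCompactSupport φ) {f : K → E} (hf : Continuous f) :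
    HasCompactSupport fun q : E × K => φ (q.1 + f q.2) := by
  have hφ' : IsCompact (tsupport φ) := hφ
  refine HasCompactSupport.intro (((hφ'.prod isCompact_univ).image
    (continuous_fst.sub (hf.comp continuous_snd))).prod isCompact_univ) fun q hq => ?_
  refine image_eq_zero_of_notMem_tsupport fun hmem => hq ⟨?_, mem_univ _⟩
  exact ⟨(q.1 + f q.2, q.2), ⟨hmem, mem_univ _⟩, add_sub_cancel_right _ _⟩

variable {N : ℕ} {r : ℝ} {ν : Measure (closedBall (0 : Space N) r)} {u φ : Space N → ℝ}

/-- The Gibbs measures with density proportional to `p ↦ exp (u (w + p))` with respect to `ν`, as a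
kernel in `w` (for `u` continuous and `ν ≠ 0`). -/
def gibbsKernel (ν : Measure (closedBall (0 : Space N) r)) [SFinite ν] (u : Space N → ℝ) :
    Kernel (Space N) (closedBall (0 : Space N) r) :=
  (Kernel.const _ ν).withDensity fun w p =>
    ENNReal.ofReal (Real.exp (u (w + p)) / partitionFunction ν u w)

theorem gibbsKernel_apply [IsFiniteMeasure ν] (hu : Continuous u) (w : Space N) :
    gibbsKernel ν u w = ν.tilted fun p => u (w + p) := by
  have hZ : Measurable (partitionFunction ν u) := (continuous_partitionFunction hu).measurable
  exact Kernel.withDensity_apply _ (by fun_prop) w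

theorem isMarkovKernel_gibbsKernel [IsFiniteMeasure ν] [NeZero ν] (hu : Continuous u) :
    IsMarkovKernel (gibbsKernel ν u) where
  isProbabilityMeasure w := by
    rw [gibbsKernel_apply hu]
    exact isProbabilityMeasure_tilted (integrable_exp_comp_add hu w)

theorem integral_gibbsKernel [IsFiniteMeasure ν] (hu : Continuous u) (w : Space N)
    (f : closedBall (0 : Space N) r → ℝ) : ∫ p, f p ∂gibbsKernel ν u w =
      ∫ p, Real.exp (u (w + p)) / partitionFunction ν u w * f p ∂ν := by
  simp only [gibbsKernel_apply hu, integral_tilted, smul_eq_mul, partitionFunction]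

theorem integral_integral_gibbsKernel [IsFiniteMeasure ν] [NeZero ν] (hu : Continuous u)
    (hφ : Continuous φ) (hφc : HasCompactSupport φ) :
    ∫ w, ∫ p, φ (w + p) ∂gibbsKernel ν u w = ∫ x, φ x * softMax ν u x := by
  have hZ : Continuous (partitionFunction ν u) := continuous_partitionFunction hu
  have hZ' (w : Space N) : partitionFunction ν u w ≠ 0 := (partitionFunction_pos hu w).ne'
  let F (w : Space N) (p : closedBall (0 : Space N) r) : ℝ :=
    Real.exp (u (w + p)) / partitionFunction ν u w * φ (w + p)
  let G (x : Space N) (p : closedBall (0 : Space N) r) : ℝ :=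
    Real.exp (u x) / partitionFunction ν u (x - p) * φ x
  have hF : Continuous F.uncurry :=
    Continuous.mul (.div (by fun_prop) (by fun_prop) fun _ => hZ' _) (by fun_prop)
  have hFc : HasCompactSupport F.uncurry :=
    HasCompactSupport.mul_left (hasCompactSupport_comp_add hφc continuous_subtype_val)
  have hG : Continuous G.uncurry := (continuous_softMax_integrand hu).mul (by fun_prop)
  have hGc : HasCompactSupport G.uncurry := by
    refine HasCompactSupport.mul_left
      (f' := fun q : Space N × closedBall (0 : Space N) r => φ q.1) ?_
    simpa only [add_zero] using
      hasCompactSupport_comp_add hφc (continuous_const (y := (0 : Space N)))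
  have hshift (p : closedBall (0 : Space N) r) : ∫ w, F w p = ∫ x, G x p := by
    have := integral_sub_right_eq_self (μ := volume) (fun w => F w p) (p : Space N)
    simpa only [F, G, sub_add_cancel] using this.symm
  calc ∫ w, ∫ p, φ (w + p) ∂gibbsKernel ν u w
      = ∫ w, ∫ p, F w p ∂ν := by simp only [integral_gibbsKernel hu, F]
    _ = ∫ p, ∫ w, F w p ∂volume ∂ν := integral_integral_swap_of_hasCompactSupport hF hFc
    _ = ∫ p, ∫ x, G x p ∂volume ∂ν := by simp only [hshift]
    _ = ∫ x, ∫ p, G x p ∂ν := (integral_integral_swap_of_hasCompactSupport hG hGc).symm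
    _ = ∫ x, φ x * softMax ν u x := by simp only [G, integral_mul_const, softMax, mul_comm (φ _)]

end GibbsKernel

section PairKernel

variable {N : ℕ} {r : ℝ} {φ : Space N → ℝ} {κ η : Kernel (Space N) (closedBall (0 : Space N) r)}

/-- The product of two kernels on the ball, as a kernel on `C_r`. -/
def pairKernel (κ η : Kernel (Space N) (closedBall (0 : Space N) r)) :
    Kernel (Space N) (ballPair N r) :=
  (κ ×ₖ η).map fun q => ⟨(q.1, q.2), q.1.2, q.2.2⟩

theorem measurable_toBallPair : Measurable fun q : closedBall (0 : Space N) r ×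
    closedBall (0 : Space N) r => (⟨(q.1, q.2), q.1.2, q.2.2⟩ : ballPair N r) :=
  Measurable.subtype_mk (by fun_prop)

theorem isMarkovKernel_pairKernel [IsMarkovKernel κ] [IsMarkovKernel η] :
    IsMarkovKernel (pairKernel κ η) :=
  Kernel.IsMarkovKernel.map _ measurable_toBallPair

theorem integral_pairDiff_pairKernel [IsMarkovKernel κ] [IsMarkovKernel η] (hφ : Continuous φ)
    (w : Space N) : ∫ p, pairDiff φ w p ∂pairKernel κ η w =
      ∫ p, φ (w + p) ∂κ w - ∫ p, φ (w + p) ∂η w := by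
  have hint (μ : Measure (closedBall (0 : Space N) r)) [IsFiniteMeasure μ] :
      Integrable (fun p : closedBall (0 : Space N) r => φ (w + p)) μ :=
    integrable_of_continuous (by fun_prop)
  rw [pairKernel, Kernel.map_apply _ measurable_toBallPair, Kernel.prod_apply,
    integral_map measurable_toBallPair.aemeasurable
      (continuous_pairDiff_right hφ w).aestronglyMeasurable]
  simp only [pairDiff]
  rw [integral_sub ((hint _).comp_fst _) ((hint _).comp_snd _),
    integral_fun_fst fun p : closedBall (0 : Space N) r => φ (w + p),
    integral_fun_snd fun p : closedBall (0 : Space N) r => φ (w + p)]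
  simp only [probReal_univ, one_smul]

theorem integral_integral_pairDiff_pairKernel [IsMarkovKernel κ] [IsMarkovKernel η]
    (hφ : Continuous φ) (hφc : HasCompactSupport φ) :
    ∫ w, ∫ p, pairDiff φ w p ∂pairKernel κ η w =
      (∫ w, ∫ p, φ (w + p) ∂κ w) - ∫ w, ∫ p, φ (w + p) ∂η w := by
  have hint (κ : Kernel (Space N) (closedBall (0 : Space N) r)) [IsMarkovKernel κ] :
      Integrable fun w => ∫ p, φ (w + p) ∂κ w :=
    (integrable_comp_add (by fun_prop) (fun p => mem_closedBall_zero_iff.1 p.2)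
      (isTestFunction_of_hasCompactSupport hφ hφc)).integral_compProd
  simp only [integral_pairDiff_pairKernel hφ]
  exact integral_sub (hint κ) (hint η)

end PairKernel

section ApproximateSolution

variable {N : ℕ} {r h : ℝ} {ν : Measure (closedBall (0 : Space N) r)} {g : Space N → ℝ} {L : ℝ≥0}

theorem le_measureReal_setOf_ballSup_sub_le [IsFiniteMeasure ν] {c δ ε : ℝ} (hr : 0 ≤ r)
    (hc : ∀ p, c ≤ ν.real (ball p δ)) {u : Space N → ℝ} (hu : LipschitzWith L u)
    (hδ : L * δ ≤ ε) (w : Space N) : c ≤ ν.real {p | ballSup r u w - ε ≤ u (w + p)} := by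
  obtain ⟨x, hx, hmax⟩ := exists_eq_ballSup hr hu.continuous w
  have hx' : x - w ∈ closedBall (0 : Space N) r := by
    rwa [mem_closedBall_zero_iff, ← dist_eq_norm]
  refine (hc ⟨x - w, hx'⟩).trans (measureReal_mono fun p hp => ?_)
  have hdist : dist x (w + p) < δ := by
    rwa [← sub_add_cancel x w, add_comm w, dist_add_right, dist_comm]
  have hle : L * dist x (w + p) ≤ L * δ := mul_le_mul_of_nonneg_left hdist.le L.2
  rw [mem_ofPred_eq, ← hmax]
  linarith [hu.le_add_mul x (w + p)]

theorem exists_ballSup_sub_integral_gibbsKernel_le [IsFiniteMeasure ν] [ν.IsOpenPosMeasure]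
    (hr : 0 ≤ r) (L : ℝ≥0) {ε : ℝ} (hε : 0 < ε) :
    ∃ β > 0, ∀ u : Space N → ℝ, LipschitzWith L u → ∀ w,
      ballSup r u w - ∫ p, u (w + p) ∂gibbsKernel ν (fun x => β * u x) w ≤ ε := by
  have : Nonempty (closedBall (0 : Space N) r) := ⟨⟨0, mem_closedBall_self hr⟩⟩
  obtain ⟨δ, hδ, hLδ⟩ := exists_pos_mul_lt (half_pos hε) L
  obtain ⟨c, hc, hball⟩ := exists_pos_forall_le_measureReal_ball ν hδ
  have hν : 0 < ν.real univ := measureReal_univ_pos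
  have hβ : 0 < 2 * ν.real univ / (c * ε) := by positivity
  refine ⟨_, hβ, fun u hu w => ?_⟩
  set β : ℝ := 2 * ν.real univ / (c * ε) with hβ_def
  have hu' : Continuous u := hu.continuous
  have hexp : Integrable (fun p : closedBall (0 : Space N) r => Real.exp (β * u (w + p))) ν :=
    integrable_of_continuous (by fun_prop)
  have : IsProbabilityMeasure (ν.tilted fun p => β * u (w + p)) := isProbabilityMeasure_tilted hexp
  calc ballSup r u w - ∫ p, u (w + p) ∂gibbsKernel ν (fun x => β * u x) w
      = ∫ p, (ballSup r u w - u (w + p)) ∂ν.tilted fun p => β * u (w + p) := by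
        rw [gibbsKernel_apply (by fun_prop), integral_sub (integrable_const _)
          (integrable_of_continuous (by fun_prop)), integral_const, probReal_univ, one_smul]
    _ ≤ ε / 2 + ν.real univ / (c * β) := by
        refine integral_sub_tilted_le hβ hexp (fun p => le_ballSup hu' ?_) hc
          (le_measureReal_setOf_ballSup_sub_le hr hball hu hLδ.le w)
        rw [mem_closedBall, dist_self_add_left]
        exact mem_closedBall_zero_iff.1 p.2
    _ = ε := by
        rw [hβ_def]
        field_simp
        ring

theorem exists_approximate_solution (hr : 0 < r) (hh : 0 < h) (hg : LipschitzWith L g) {ε : ℝ}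
    (hε : 0 < ε) : ∃ u : Space N → ℝ, LipschitzWith L u ∧
      ∃ κ : Kernel (Space N) (ballPair N r), IsMarkovKernel κ ∧
        (∀ w, ballOsc r u w - ε ≤ ∫ p, pairDiff u w p ∂κ w) ∧
        ∀ φ : Space N → ℝ, Continuous φ → HasCompactSupport φ →
          h / (2 * r) * ∫ w, ∫ p, pairDiff φ w p ∂κ w = ∫ w, φ w * (g w - u w) := by
  let ν : Measure (closedBall (0 : Space N) r) := (volume : Measure (Space N)).comap (↑)
  have : IsFiniteMeasure ν := ⟨by
    rw [comap_subtype_coe_apply measurableSet_closedBall, image_univ, Subtype.range_coe]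
    exact measure_closedBall_lt_top⟩
  have : ν.IsOpenPosMeasure := isOpenPosMeasure_comap_closedBall volume 0 hr.ne'
  have hne : Nonempty (closedBall (0 : Space N) r) := ⟨⟨0, mem_closedBall_self hr.le⟩⟩
  obtain ⟨β, hβ, hsup⟩ := exists_ballSup_sub_integral_gibbsKernel_le (ν := ν) hr.le L (half_pos hε)
  obtain ⟨u, hu, heq⟩ := exists_lipschitzWith_add_softMax_sub_softMax_eq (ν := ν)
    (c := h / (2 * r)) (by positivity) hβ hg
  have hu' : Continuous u := hu.continuous
  let κ := gibbsKernel ν fun x => β * u x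
  let η := gibbsKernel ν fun x => -(β * u x)
  have hκ : IsMarkovKernel κ := isMarkovKernel_gibbsKernel (by fun_prop)
  have hη : IsMarkovKernel η := isMarkovKernel_gibbsKernel (by fun_prop)
  refine ⟨u, hu, pairKernel κ η, isMarkovKernel_pairKernel, fun w => ?_, fun φ hφ hφc => ?_⟩
  · have h₁ := hsup u hu w
    have h₂ := hsup (fun x => -u x) hu.neg w
    simp only [mul_neg, integral_neg] at h₂
    rw [integral_pairDiff_pairKernel hu', ballOsc, ballInf_eq_neg_ballSup_neg]
    linarith
  · have hint (v : Space N → ℝ) (hv : Continuous v) : Integrable fun x => φ x * softMax ν v x :=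
      (hφ.mul (continuous_softMax hv)).integrable_of_hasCompactSupport hφc.mul_right
    rw [integral_integral_pairDiff_pairKernel hφ hφc,
      integral_integral_gibbsKernel (by fun_prop) hφ hφc,
      integral_integral_gibbsKernel (by fun_prop) hφ hφc,
      ← integral_sub (hint _ (by fun_prop)) (hint _ (by fun_prop)), ← integral_const_mul]
    refine integral_congr_ae (ae_of_all _ fun x => ?_)
    simp only [← heq x]
    ring

end ApproximateSolution

section UniformBound

variable {N : ℕ} {r : ℝ} {φ f : Space N → ℝ}

theorem pairDiff_eq_zero_of_notMem_closedBall {x w : Space N} {R : ℝ}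
    (hφ : ∀ y ∉ closedBall x R, φ y = 0) (hw : w ∉ closedBall x (R + r)) (p : ballPair N r) :
    pairDiff φ w p = 0 := by
  have hzero {y : Space N} (hy : y ∈ closedBall w r) : φ y = 0 := by
    refine hφ y fun hyx => hw ?_
    rw [mem_closedBall, dist_comm] at hy
    exact (dist_triangle w y x).trans (by linarith [mem_closedBall.1 hyx])
  rw [pairDiff, hzero (add_fst_mem_closedBall w p), hzero (add_snd_mem_closedBall w p), sub_zero]

theorem abs_integral_integral_pairDiff_le (κ : Kernel (Space N) (ballPair N r)) [IsMarkovKernel κ]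
    {x : Space N} {M R : ℝ} (hφ₀ : ∀ y, 0 ≤ φ y) (hφM : ∀ y, φ y ≤ M)
    (hφ : ∀ y ∉ closedBall x R, φ y = 0) :
    |∫ w, ∫ p, pairDiff φ w p ∂κ w| ≤ M * volume.real (closedBall (0 : Space N) (R + r)) := by
  have hle (w : Space N) : ‖∫ p, pairDiff φ w p ∂κ w‖ ≤ M := by
    have := norm_integral_le_of_norm_le_const (μ := κ w) (ae_of_all _ fun p =>
      show ‖pairDiff φ w p‖ ≤ M from
        abs_sub_le_of_nonneg_of_le (hφ₀ _) (hφM _) (hφ₀ _) (hφM _))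
    rwa [probReal_univ, mul_one] at this
  have hzero (w) (hw : w ∉ closedBall x (R + r)) : ∫ p, pairDiff φ w p ∂κ w = 0 := by
    simp only [pairDiff_eq_zero_of_notMem_closedBall hφ hw, integral_zero]
  rw [← setIntegral_eq_integral_of_forall_compl_eq_zero hzero, measureReal_def,
    ← Measure.addHaar_closedBall_center volume x]
  exact norm_setIntegral_le_of_norm_le_const measure_closedBall_lt_top fun w _ => hle w

theorem exists_forall_abs_le_of_forall_mul_integral_integral_pairDiff_eq (N : ℕ) (r c : ℝ)
    (K : ℝ≥0) : ∃ C, ∀ (κ : Kernel (Space N) (ballPair N r)) [IsMarkovKernel κ]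
      (f : Space N → ℝ), LipschitzWith K f →
      (∀ φ : Space N → ℝ, Continuous φ → HasCompactSupport φ →
        c * ∫ w, ∫ p, pairDiff φ w p ∂κ w = ∫ w, φ w * f w) →
      ∀ x, |f x| ≤ C := by
  let b : ContDiffBump (0 : Space N) := ⟨1 / 2, 1, by norm_num, by norm_num⟩
  obtain ⟨M, hM⟩ := (b.continuous_normed (μ := volume)).bounded_above_of_compact_support
    b.hasCompactSupport_normed
  refine ⟨K + |c| * (M * volume.real (closedBall (0 : Space N) (1 + r))),
    fun κ _ f hf heq x => ?_⟩
  let φ (y : Space N) : ℝ := b.normed volume (x - y)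
  have hφ_zero (y) (hy : y ∉ closedBall x 1) : φ y = 0 := by
    refine image_eq_zero_of_notMem_tsupport (f := b.normed volume) fun hmem => hy ?_
    rw [b.tsupport_normed_eq, mem_closedBall_zero_iff] at hmem
    rwa [mem_closedBall, dist_comm, dist_eq_norm]
  have hφc : HasCompactSupport φ := HasCompactSupport.intro (isCompact_closedBall x 1) hφ_zero
  have hφ : Continuous φ := b.continuous_normed.comp (continuous_const.sub continuous_id)
  have hconv : |(∫ y, φ y * f y) - f x| ≤ K := by
    have hfx (y) (hy : y ∈ ball x b.rOut) : dist (f y) (f x) ≤ K := by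
      simpa only [b, mul_one] using hf.dist_le_mul_of_le (mem_ball.1 hy).le
    have := b.dist_normed_convolution_le (μ := volume) hf.continuous.aestronglyMeasurable hfx
    rw [convolution_def, Real.dist_eq] at this
    rw [← integral_sub_left_eq_self (fun y => φ y * f y) volume x]
    simpa only [φ, sub_sub_cancel, ContinuousLinearMap.lsmul_apply, smul_eq_mul] using this
  have hbound : |∫ y, φ y * f y| ≤ |c| * (M * volume.real (closedBall (0 : Space N) (1 + r))) := by
    rw [← heq φ hφ hφc, abs_mul]
    gcongr
    exact abs_integral_integral_pairDiff_le κ (fun y => b.nonneg_normed _)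
      (fun y => (le_abs_self _).trans (hM _)) hφ_zero
  calc |f x| ≤ |(∫ y, φ y * f y) - f x| + |∫ y, φ y * f y| := by
        rw [abs_sub_comm]
        linarith [abs_sub_abs_le_abs_sub (f x) (∫ y, φ y * f y)]
    _ ≤ K + |c| * (M * volume.real (closedBall (0 : Space N) (1 + r))) := add_le_add hconv hbound

end UniformBound

section KernelCompactness

open scoped BoundedContinuousFunction

variable {X K : Type*} [TopologicalSpace X] [PolishSpace X] [MeasurableSpace X] [BorelSpace X]
  [MetricSpace K] [CompactSpace K] [MeasurableSpace K] [BorelSpace K] {ν : Measure X}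

omit [BorelSpace K] in
theorem isTightMeasureSet_compProd [IsFiniteMeasure ν] {ι : Type*} (κ : ι → Kernel X K)
    [∀ i, IsMarkovKernel (κ i)] : IsTightMeasureSet (range fun i => ν ⊗ₘ κ i) := by
  refine IsTightMeasureSet.prodMk ?_ .of_compactSpace
  refine (isTightMeasureSet_singleton (μ := ν)).subset ?_
  rintro _ ⟨_, ⟨i, rfl⟩, rfl⟩
  exact Measure.fst_compProd ν (κ i)

theorem exists_markovKernel_subseq_tendsto_integral_compProd [IsProbabilityMeasure ν] [Nonempty K]
    (κ : ℕ → Kernel X K) [∀ n, IsMarkovKernel (κ n)] :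
    ∃ η : Kernel X K, IsMarkovKernel η ∧ ∃ φ : ℕ → ℕ, StrictMono φ ∧ ∀ F : X × K →ᵇ ℝ,
      Tendsto (fun n => ∫ q, F q ∂(ν ⊗ₘ κ (φ n))) atTop (𝓝 (∫ q, F q ∂(ν ⊗ₘ η))) := by
  let P (n : ℕ) : ProbabilityMeasure (X × K) := ⟨ν ⊗ₘ κ n, inferInstance⟩
  have htight : IsTightMeasureSet (ProbabilityMeasure.toMeasure '' range P) := by
    rw [← range_comp]
    exact isTightMeasureSet_compProd κ
  obtain ⟨Q, -, φ, hφ, hQ⟩ := (isCompact_closure_of_isTightMeasureSet htight).tendsto_subseq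
    fun n => subset_closure (mem_range_self (f := P) n)
  have hfst : (Q : Measure (X × K)).fst = ν := by
    have hmap := ProbabilityMeasure.tendsto_map_of_tendsto_of_continuous _ _ hQ continuous_fst
    have hconst (n : ℕ) : ((P ∘ φ) n).map continuous_fst.measurable.aemeasurable =
        (⟨ν, inferInstance⟩ : ProbabilityMeasure X) :=
      ProbabilityMeasure.toMeasure_injective (Measure.fst_compProd ν (κ (φ n)))
    simp only [hconst] at hmap
    exact congrArg ProbabilityMeasure.toMeasure (tendsto_nhds_unique hmap tendsto_const_nhds)
  refine ⟨(Q : Measure (X × K)).condKernel, inferInstance, φ, hφ, fun F => ?_⟩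
  have hdis : ν ⊗ₘ (Q : Measure (X × K)).condKernel = Q := by
    rw [← hfst]
    exact (Q : Measure (X × K)).disintegrate _
  rw [hdis]
  exact ProbabilityMeasure.tendsto_iff_forall_integral_tendsto.1 hQ F

theorem integrable_exp_neg_sq_norm {E : Type*} [NormedAddCommGroup E] [InnerProductSpace ℝ E]
    [FiniteDimensional ℝ E] [MeasurableSpace E] [BorelSpace E] :
    Integrable fun x : E => Real.exp (-‖x‖ ^ 2) := by
  have := GaussianFourier.integral_rexp_neg_mul_sq_norm (V := E) one_pos
  simp only [neg_mul, one_mul] at this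
  exact .of_integral_ne_zero (this ▸ by positivity)

theorem exists_markovKernel_subseq_tendsto_integral_integral {E : Type*} [NormedAddCommGroup E]
    [InnerProductSpace ℝ E] [FiniteDimensional ℝ E] [MeasurableSpace E] [BorelSpace E] [Nonempty K]
    (κ : ℕ → Kernel E K) [∀ n, IsMarkovKernel (κ n)] :
    ∃ η : Kernel E K, IsMarkovKernel η ∧ ∃ φ : ℕ → ℕ, StrictMono φ ∧
      ∀ F : E × K → ℝ, Continuous F → HasCompactSupport F →
        Tendsto (fun n => ∫ w, ∫ p, F (w, p) ∂κ (φ n) w) atTop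
          (𝓝 (∫ w, ∫ p, F (w, p) ∂η w)) := by
  let ν : Measure E := (volume : Measure E).tilted fun x => -‖x‖ ^ 2
  have hν : IsProbabilityMeasure ν := isProbabilityMeasure_tilted integrable_exp_neg_sq_norm
  let ρ (x : E) : ℝ := Real.exp (-‖x‖ ^ 2) / ∫ y : E, Real.exp (-‖y‖ ^ 2)
  have hρ (x : E) : ρ x ≠ 0 :=
    (div_pos (Real.exp_pos _) (integral_exp_pos integrable_exp_neg_sq_norm)).ne'
  have hρc : Continuous ρ := by fun_prop
  obtain ⟨η, hη, φ, hφ, hlim⟩ := exists_markovKernel_subseq_tendsto_integral_compProd (ν := ν) κ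
  refine ⟨η, hη, φ, hφ, fun F hF hFc => ?_⟩
  have hG : Continuous fun q : E × K => F q / ρ q.1 := hF.div (by fun_prop) fun q => hρ q.1
  have hGc : HasCompactSupport fun q : E × K => F q / ρ q.1 := by
    simp only [div_eq_mul_inv]
    exact hFc.mul_right
  obtain ⟨C, hC⟩ := hG.bounded_above_of_compact_support hGc
  have hreweight (κ : Kernel E K) [IsMarkovKernel κ] :
      ∫ q, F q / ρ q.1 ∂(ν ⊗ₘ κ) = ∫ w, ∫ p, F (w, p) ∂κ w := by
    rw [Measure.integral_compProd (.of_bound hG.aestronglyMeasurable C (ae_of_all _ hC)),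
      integral_tilted]
    simp only [integral_div, smul_eq_mul]
    exact integral_congr_ae (ae_of_all _ fun w => mul_div_cancel₀ _ (hρ w))
  simpa only [BoundedContinuousFunction.coe_ofNormedAddCommGroup, hreweight] using
    hlim (.ofNormedAddCommGroup _ hG C hC)

end KernelCompactness

section ArzelaAscoli

variable {X : Type*} [PseudoMetricSpace X] {L : ℝ≥0}

theorem isCompact_setOf_lipschitzWith_abs_le (L : ℝ≥0) (C : X → ℝ) :
    IsCompact {f : C(X, ℝ) | LipschitzWith L f ∧ ∀ x, |f x| ≤ C x} := by
  refine ArzelaAscoli.isCompact_of_equicontinuous _ ?_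
    (LipschitzWith.uniformEquicontinuous _ L fun f => f.2.1).equicontinuous
  have himage : ContinuousMap.toFun '' {f : C(X, ℝ) | LipschitzWith L f ∧ ∀ x, |f x| ≤ C x} =
      univ.pi (fun x => Icc (-C x) (C x)) ∩ {f | LipschitzWith L f} := by
    ext f
    constructor
    · rintro ⟨f, ⟨hf, hC⟩, rfl⟩
      exact ⟨fun x _ => abs_le.1 (hC x), hf⟩
    · rintro ⟨hC, hf⟩
      exact ⟨⟨f, hf.continuous⟩, ⟨hf, fun x => abs_le.2 (hC x trivial)⟩, rfl⟩
  rw [himage]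
  exact (isCompact_univ_pi fun _ => isCompact_Icc).inter_right (isClosed_setOfPred_lipschitzWith L)

theorem exists_subseq_tendstoLocallyUniformly [WeaklyLocallyCompactSpace X] [SigmaCompactSpace X]
    {u : ℕ → X → ℝ} (hu : ∀ n, LipschitzWith L (u n)) {C : X → ℝ} (hC : ∀ n x, |u n x| ≤ C x) :
    ∃ v, LipschitzWith L v ∧ ∃ φ : ℕ → ℕ, StrictMono φ ∧
      TendstoLocallyUniformly (fun n => u (φ n)) v atTop := by
  obtain ⟨v, hv, φ, hφ, hlim⟩ := (isCompact_setOf_lipschitzWith_abs_le L C).tendsto_subseq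
    (x := fun n => ⟨u n, (hu n).continuous⟩) fun n => ⟨hu n, hC n⟩
  exact ⟨v, hv.1, φ, hφ, ContinuousMap.tendsto_iff_tendstoLocallyUniformly.1 hlim⟩

end ArzelaAscoli

section Limit

variable {N : ℕ} {r h : ℝ} {g v φ : Space N → ℝ} {L : ℝ≥0}

theorem abs_integral_pairDiff_le_ballOsc {μ : Measure (ballPair N r)} [IsProbabilityMeasure μ]
    (hφ : Continuous φ) (w : Space N) : |∫ p, pairDiff φ w p ∂μ| ≤ ballOsc r φ w := by
  have := norm_integral_le_of_norm_le_const (μ := μ) (ae_of_all _ fun p =>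
    show ‖pairDiff φ w p‖ ≤ ballOsc r φ w from abs_sub_le_iff.2
      ⟨sub_le_ballOsc hφ (add_fst_mem_closedBall w p) (add_snd_mem_closedBall w p),
        sub_le_ballOsc hφ (add_snd_mem_closedBall w p) (add_fst_mem_closedBall w p)⟩)
  rwa [probReal_univ, mul_one] at this

theorem hasCompactSupport_pairDiff (hφ : HasCompactSupport φ) :
    HasCompactSupport fun q : Space N × ballPair N r => pairDiff φ q.1 q.2 := by
  have h₁ := hasCompactSupport_comp_add hφ (f := fun p : ballPair N r => p.1.1) (by fun_prop)
  have h₂ := hasCompactSupport_comp_add hφ (f := fun p : ballPair N r => p.1.2) (by fun_prop)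
  exact h₁.sub h₂

theorem tendsto_integral_pairDiff {u : ℕ → Space N → ℝ} {μ : ℕ → Measure (ballPair N r)}
    [∀ n, IsProbabilityMeasure (μ n)] {ε : ℕ → ℝ} {w : Space N} (hr : 0 ≤ r)
    (hu : ∀ n, Continuous (u n)) (huv : TendstoLocallyUniformly u v atTop)
    (hε : Tendsto ε atTop (𝓝 0))
    (hosc : ∀ n, ballOsc r (u n) w - ε n ≤ ∫ p, pairDiff (u n) w p ∂μ n) :
    Tendsto (fun n => ∫ p, pairDiff v w p ∂μ n) atTop (𝓝 (ballOsc r v w)) := by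
  have hv : Continuous v := huv.continuous (Frequently.of_forall hu)
  refine Metric.tendsto_nhds.2 fun δ hδ => ?_
  have hunif : TendstoUniformlyOn u v atTop (closedBall w r) :=
    (tendstoLocallyUniformlyOn_iff_tendstoUniformlyOn_of_compact (isCompact_closedBall w r)).1
      huv.tendstoLocallyUniformlyOn
  filter_upwards [Metric.tendstoUniformlyOn_iff.1 hunif (δ / 8) (by positivity),
    hε.eventually_lt_const (half_pos hδ)] with n hn hεn
  have hdist (x) (hx : x ∈ closedBall w r) : |v x - u n x| ≤ δ / 8 := (hn x hx).le
  have hv_le : ballOsc r v w ≤ ballOsc r (u n) w + 2 * (δ / 8) :=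
    ballOsc_le_add hr hv (hu n) hdist
  have hdiff : ∫ p, pairDiff (u n) w p ∂μ n - ∫ p, pairDiff v w p ∂μ n ≤ 2 * (δ / 8) := by
    rw [← integral_pairDiff_sub (hu n) hv]
    refine (integral_pairDiff_le_ballOsc hr prob_le_one ((hu n).sub hv) w).trans ?_
    have hsup : ballSup r (fun x => u n x - v x) w ≤ δ / 8 :=
      ballSup_le hr fun x hx => by linarith [(abs_le.1 (hdist x hx)).1]
    have hinf : -(δ / 8) ≤ ballInf r (fun x => u n x - v x) w :=
      le_ballInf hr fun x hx => by linarith [(abs_le.1 (hdist x hx)).2]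
    exact (sub_le_sub hsup hinf).trans_eq (by ring)
  have hle := integral_pairDiff_le_ballOsc hr (prob_le_one (μ := μ n)) hv w
  rw [Real.dist_eq, abs_sub_lt_iff]
  constructor <;> linarith [hosc n]

theorem ae_integral_pairDiff_eq_ballOsc {κ : ℕ → Kernel (Space N) (ballPair N r)}
    [∀ n, IsMarkovKernel (κ n)] {η : Kernel (Space N) (ballPair N r)} [IsMarkovKernel η]
    (hv : Continuous v)
    (hη : ∀ F : Space N × ballPair N r → ℝ, Continuous F → HasCompactSupport F →
      Tendsto (fun n => ∫ w, ∫ p, F (w, p) ∂κ n w) atTop (𝓝 (∫ w, ∫ p, F (w, p) ∂η w)))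
    (hosc : ∀ w, Tendsto (fun n => ∫ p, pairDiff v w p ∂κ n w) atTop (𝓝 (ballOsc r v w))) :
    ∀ᵐ w, ∫ p, pairDiff v w p ∂η w = ballOsc r v w := by
  have hmeas (κ : Kernel (Space N) (ballPair N r)) [IsMarkovKernel κ] :
      StronglyMeasurable fun w => ∫ p, pairDiff v w p ∂κ w :=
    (continuous_pairDiff hv).stronglyMeasurable.integral_kernel_prod_right'
  have hcont : Continuous (ballOsc r v) := continuous_ballOsc r hv
  refine ae_eq_of_integral_contDiff_smul_eq ?_ hcont.locallyIntegrable fun φ hφ hc => ?_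
  · refine hcont.locallyIntegrable.mono (hmeas η).aestronglyMeasurable (ae_of_all _ fun w => ?_)
    exact (abs_integral_pairDiff_le_ballOsc hv w).trans (le_abs_self _)
  · have hc_fst : HasCompactSupport fun q : Space N × ballPair N r => φ q.1 := by
      simpa only [add_zero] using hasCompactSupport_comp_add hc (f := fun _ => 0) continuous_const
    have hη_lim := hη (fun q => φ q.1 * pairDiff v q.1 q.2)
      ((hφ.continuous.comp continuous_fst).mul (continuous_pairDiff hv)) hc_fst.mul_right
    simp only [integral_const_mul] at hη_lim
    refine tendsto_nhds_unique hη_lim ?_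
    refine tendsto_integral_of_dominated_convergence (fun w => |φ w| * ballOsc r v w)
      (fun n => ?_) ?_ (fun n => ae_of_all _ fun w => ?_) (ae_of_all _ fun w => ?_)
    · exact hφ.continuous.aestronglyMeasurable.mul (hmeas (κ n)).aestronglyMeasurable
    · exact (hφ.continuous.abs.mul hcont).integrable_of_hasCompactSupport hc.abs.mul_right
    · rw [norm_mul]
      exact mul_le_mul_of_nonneg_left (abs_integral_pairDiff_le_ballOsc hv w) (norm_nonneg _)
    · exact (hosc w).const_mul _

theorem tendsto_integral_mul_sub {u : ℕ → Space N → ℝ} {C : ℝ} (hu : ∀ n, Continuous (u n))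
    (hg : Continuous g) (huv : ∀ w, Tendsto (fun n => u n w) atTop (𝓝 (v w)))
    (hC : ∀ n w, |g w - u n w| ≤ C) (hφ : Continuous φ) (hc : HasCompactSupport φ) :
    Tendsto (fun n => ∫ w, φ w * (g w - u n w)) atTop (𝓝 (∫ w, φ w * (g w - v w))) := by
  refine tendsto_integral_of_dominated_convergence (fun w => |φ w| * C)
    (fun n => (hφ.mul (hg.sub (hu n))).aestronglyMeasurable)
    ((hφ.abs.mul continuous_const).integrable_of_hasCompactSupport hc.abs.mul_right)
    (fun n => ae_of_all _ fun w => ?_) (ae_of_all _ fun w => ((huv w).const_sub _).const_mul _)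
  rw [norm_mul]
  exact mul_le_mul_of_nonneg_left (hC n w) (norm_nonneg _)

theorem exists_isCalibratingKernel (hr : 0 < r) (hh : 0 < h) (hg : LipschitzWith L g) :
    ∃ v, LipschitzWith L v ∧ (∃ C, ∀ x, |g x - v x| ≤ C) ∧ ∃ κ, IsCalibratingKernel r h g v κ := by
  obtain ⟨C, hC⟩ := exists_forall_abs_le_of_forall_mul_integral_integral_pairDiff_eq N r
    (h / (2 * r)) (L + L)
  choose u hu κ hκ hosc heq using fun n : ℕ =>
    exists_approximate_solution hr hh hg (Nat.one_div_pos_of_nat (α := ℝ) (n := n))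
  have hgu (n x) : |g x - u n x| ≤ C := hC (κ n) _ (hg.sub (hu n)) (heq n) x
  have hbound (n x) : |u n x| ≤ |g x| + C := by
    linarith [abs_sub_abs_le_abs_sub (u n x) (g x), hgu n x, abs_sub_comm (u n x) (g x)]
  obtain ⟨v, hv, φ, hφ, huv⟩ := exists_subseq_tendstoLocallyUniformly hu hbound
  have : Nonempty (ballPair N r) :=
    ⟨⟨(0, 0), mem_closedBall_self hr.le, mem_closedBall_self hr.le⟩⟩
  obtain ⟨η, hη, ψ, hψ, hlim⟩ :=
    exists_markovKernel_subseq_tendsto_integral_integral fun n => κ (φ n)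
  have huv' : TendstoLocallyUniformly (fun n => u (φ (ψ n))) v atTop :=
    fun s hs x => (huv s hs x).imp fun t ⟨ht, hev⟩ => ⟨ht, hψ.tendsto_atTop.eventually hev⟩
  have hpt (w) : Tendsto (fun n => u (φ (ψ n)) w) atTop (𝓝 (v w)) :=
    huv'.tendstoLocallyUniformlyOn.tendsto_at (mem_univ w)
  refine ⟨v, hv, ⟨C, fun x => ?_⟩, η, fun w => prob_le_one, ?_, fun χ hχ hc => ?_⟩
  · exact le_of_tendsto ((hpt x).const_sub _).abs (Eventually.of_forall fun n => hgu _ x)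
  · refine ae_integral_pairDiff_eq_ballOsc hv.continuous hlim fun w => ?_
    exact tendsto_integral_pairDiff hr.le (fun n => (hu _).continuous) huv'
      (tendsto_one_div_add_atTop_nhds_zero_nat.comp (hφ.comp hψ).tendsto_atTop)
      fun n => hosc _ w
  · have hlhs := (hlim _ (continuous_pairDiff hχ) (hasCompactSupport_pairDiff hc)).const_mul
      (h / (2 * r))
    simp only [heq _ χ hχ hc] at hlhs
    exact tendsto_nhds_unique hlhs (tendsto_integral_mul_sub (fun n => (hu _).continuous)
      hg.continuous hpt (fun n => hgu _) hχ hc)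

end Limit

section Existence

variable {N : ℕ} {r h : ℝ} {g u : Space N → ℝ} {K : ℝ≥0} {S : Set (Space N → ℝ)}

theorem mem_of_abs_sub_le (hS : S = LipPlus N ∨ S = LipMinus N) (hg : g ∈ S)
    (hu : LipschitzWith K u) {C : ℝ} (hC : ∀ x, |g x - u x| ≤ C) : u ∈ S := by
  rcases hS with rfl | rfl
  · refine ⟨⟨K, hu⟩, tendsto_atTop_mono (fun x => ?_) (tendsto_atTop_add_const_right _ (-C) hg.2)⟩
    linarith [(abs_le.1 (hC x)).2]
  · refine ⟨⟨K, hu⟩, tendsto_atBot_mono (fun x => ?_) (tendsto_atBot_add_const_right _ C hg.2)⟩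
    linarith [(abs_le.1 (hC x)).1]

theorem exists_isSolution_lipschitzWith (hr : 0 < r) (hh : 0 < h)
    (hS : S = LipPlus N ∨ S = LipMinus N) (hg : g ∈ S) (hK : LipschitzWith K g) :
    ∃ u ∈ S, LipschitzWith K u ∧ IsSolution r h g u := by
  obtain ⟨u, hu, ⟨C, hC⟩, hκ⟩ := exists_isCalibratingKernel hr hh hK
  exact ⟨u, mem_of_abs_sub_le hS hg hu hC, hu,
    (isSolution_iff_exists_isCalibratingKernel hr hK.continuous hu.continuous).2 hκ⟩

theorem lipConst_le_of_forall_lipschitzWith (hgu : ∀ K, LipschitzWith K g → LipschitzWith K u) :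
    lipConst u ≤ lipConst g :=
  le_iInf₂ fun K hK => iInf₂_le K (hgu K hK)

theorem exists_isSolution_unique_lipConst_le (hr : 0 < r) (hh : 0 < h)
    (hS : S = LipPlus N ∨ S = LipMinus N) (hg : g ∈ S) :
    ∃ u ∈ S, IsSolution r h g u ∧ (∀ v ∈ S, IsSolution r h g v → v = u) ∧
      lipConst u ≤ lipConst g := by
  have hpair {v} (hv : v ∈ S) :
      (g ∈ LipPlus N ∧ v ∈ LipPlus N) ∨ (g ∈ LipMinus N ∧ v ∈ LipMinus N) :=
    hS.imp (by rintro rfl; exact ⟨hg, hv⟩) (by rintro rfl; exact ⟨hg, hv⟩)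
  have hunique {u v} (hu : u ∈ S) (hv : v ∈ S) (hsu : IsSolution r h g u)
      (hsv : IsSolution r h g v) : v = u :=
    le_antisymm (le_of_isSolution hr hh (hpair hv) (hpair hu) hsv hsu fun _ => le_rfl)
      (le_of_isSolution hr hh (hpair hu) (hpair hv) hsu hsv fun _ => le_rfl)
  obtain ⟨L, hL⟩ : ∃ L, LipschitzWith L g := by
    rcases hS with rfl | rfl <;> exact hg.1
  obtain ⟨u, hu, -, hsu⟩ := exists_isSolution_lipschitzWith hr hh hS hg hL
  refine ⟨u, hu, hsu, fun v hv => hunique hu hv hsu,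
    lipConst_le_of_forall_lipschitzWith fun K hK => ?_⟩
  obtain ⟨v, hv, hvK, hsv⟩ := exists_isSolution_lipschitzWith hr hh hS hg hK
  rwa [← hunique hu hv hsu hsv]

end Existence

end NonlocalROF

end

theorem theorem3p2 (N : ℕ) (r h : ℝ) (hr : 0 < r) (hh : 0 < h) :
    (∀ g ∈ NonlocalROF.LipPlus N,
      ∃ u ∈ NonlocalROF.LipPlus N,
        NonlocalROF.IsSolution r h g u ∧
        (∀ v ∈ NonlocalROF.LipPlus N, NonlocalROF.IsSolution r h g v → v = u) ∧
        NonlocalROF.lipConst u ≤ NonlocalROF.lipConst g ∧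
        ∀ t : ℝ,
          NonlocalROF.IsMinimalMinimizer r h (fun w => g w - t) {w | u w < t} ∧
          NonlocalROF.IsMaximalMinimizer r h (fun w => g w - t) {w | u w ≤ t}) ∧
    (∀ g ∈ NonlocalROF.LipMinus N,
      ∃ u ∈ NonlocalROF.LipMinus N,
        NonlocalROF.IsSolution r h g u ∧
        (∀ v ∈ NonlocalROF.LipMinus N, NonlocalROF.IsSolution r h g v → v = u) ∧
        NonlocalROF.lipConst u ≤ NonlocalROF.lipConst g ∧
        ∀ t : ℝ,
          NonlocalROF.IsMinimalMinimizer r h (fun w => t - g w) {w | t < u w} ∧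
          NonlocalROF.IsMaximalMinimizer r h (fun w => t - g w) {w | t ≤ u w}) ∧
    (∀ g₁ g₂ u₁ u₂ : NonlocalROF.Space N → ℝ,
      ((g₁ ∈ NonlocalROF.LipPlus N ∧ u₁ ∈ NonlocalROF.LipPlus N) ∨
        (g₁ ∈ NonlocalROF.LipMinus N ∧ u₁ ∈ NonlocalROF.LipMinus N)) →
      ((g₂ ∈ NonlocalROF.LipPlus N ∧ u₂ ∈ NonlocalROF.LipPlus N) ∨
        (g₂ ∈ NonlocalROF.LipMinus N ∧ u₂ ∈ NonlocalROF.LipMinus N)) →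
      NonlocalROF.IsSolution r h g₁ u₁ → NonlocalROF.IsSolution r h g₂ u₂ →
      (∀ w, g₁ w ≤ g₂ w) → ∀ w, u₁ w ≤ u₂ w) := by
  refine ⟨fun g hg => ?_, fun g hg => ?_, fun _ _ _ _ h₁ h₂ hs₁ hs₂ hle =>
    NonlocalROF.le_of_isSolution hr hh h₁ h₂ hs₁ hs₂ hle⟩
  · obtain ⟨u, hu, hs, huniq, hlip⟩ :=
      NonlocalROF.exists_isSolution_unique_lipConst_le hr hh (.inl rfl) hg
    exact ⟨u, hu, hs, huniq, hlip,
      NonlocalROF.isMinimalMinimizer_and_isMaximalMinimizer hr hh hg hu hs⟩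
  · obtain ⟨u, hu, hs, huniq, hlip⟩ :=
      NonlocalROF.exists_isSolution_unique_lipConst_le hr hh (.inr rfl) hg
    exact ⟨u, hu, hs, huniq, hlip,
      NonlocalROF.isMinimalMinimizer_and_isMaximalMinimizer_of_lipMinus hr hh hg hu hs⟩
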